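/- Let $R$ be a commutative $\mathbb{Q}$-algebra (scalars and parameters), let $Q,\Theta$ be formal variables and $S=R[\Theta,\Theta^{-1}][[Q]]$. Let $\mathcal F$ be the fermionic Fock space with orthonormal basis $\underline A=\underline{a_1}\wedge\underline{a_2}\wedge\cdots$ indexed by the sets $A=\{a_1>a_2>\cdots\}\subset\mathbb Z+\frac12$ that differ from $\{-\frac12,-\frac32,\dots\}$ in finitely many elements. Let $\psi_r$ be the operator that sends $\underline A$ to $0$ if $r\in A$, and to $(-1)^k\,\underline{A\cup\{r\}}$ otherwise, where $k=\#\{a\in A: a>r\}$, and let $\psi_r^*$ be its adjoint. On $\mathcal F_1\otimes\cdots\otimes\mathcal F_N$ (copies of $\mathcal F$) let $\psi^i_r,\psi^{i*}_r$ act on the $i$-th factor with the Koszul sign convention, and let $|0\rangle$ be the vacuum. Vectors are formal, possibly infinite, linear combinations of the basis with coefficients in $S$. For an integer $n$ put $\mathbf n=n+\frac12$. A vector is a Bogoliubov transform if it has the form $\exp\big(\sum_{i,j}\sum_{m,n\ge0}A^{ij}_{mn}\psi^i_{\mathbf m}\psi^{j*}_{-\mathbf n}\big)|0\rangle$ with $A^{ij}_{mn}\in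 S$. Let $$V_1=\exp\Big(\sum_{i,j\in\{1,\dots,M,a\}}\sum_{m,n\ge0}A^{ij}_{mn}\psi^i_{\mathbf m}\psi^{j*}_{-\mathbf n}\Big)|0\rangle\in\mathcal F_1\otimes\cdots\otimes\mathcal F_M\otimes\mathcal F_a,$$ $$V_2=\exp\Big(\sum_{i,j\in\{M+1,\dots,M+N,b\}}\sum_{m,n\ge0}A^{ij}_{mn}\psi^i_{\mathbf m}\psi^{j*}_{-\mathbf n}\Big)|0\rangle\in\mathcal F_{M+1}\otimes\cdots\otimes\mathcal F_{M+N}\otimes\mathcal F_b$$ be Bogoliubov transforms ($M,N\ge0$), let $E^{ij}_{mn}\in S$ for $i,j\in\{a,b\}$, $m,n\ge0$, and let $$P^{\mathbf E}_{ab}=\exp\Big(\sum_{i,j=a,b}\sum_{m,n\ge0}Q^{m+n+1}\Theta^{\epsilon_{ij}}E^{ij}_{mn}\psi^i_{\mathbf m}\psi^{j*}_{-\mathbf n}\Big)|0\rangle\in\mathcal F_a\otimes\mathcal F_b,\qquad \epsilon_{ab}=1,\ \epsilon_{ba}=-1,\ \epsilon_{aa}=\epsilon_{bb}=0 .$$ Regard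 $V_1\otimes V_2$ as a vector in $\mathcal F_1\otimes\cdots\otimes\mathcal F_{M+N}\otimes\mathcal F_a\otimes\mathcal F_b$, reordering the factors with the Koszul sign. Then: 1. $V_1\otimes V_2=\exp\big(\sum_{i,j\in\{1,\dots,M+N,a,b\}}\sum_{m,n\ge0}A^{ij}_{mn}\psi^i_{\mathbf m}\psi^{j*}_{-\mathbf n}\big)|0\rangle$, where $A^{ij}_{mn}=0$ if $i,j$ do not both lie in $\{1,\dots,M,a\}$ or both in $\{M+1,\dots,M+N,b\}$. 2. The bilinear inner products over the components $\mathcal F_a\otimes\mathcal F_b$ $$\tilde G=(V_1\otimes V_2,\,P^{\mathbf E}_{ab}),\qquad \tilde G_{closed}=\Big(\exp\Big(\sum_{i,j=a,b}\sum_{m,n\ge0}A^{ij}_{mn}\psi^i_{\mathbf m}\psi^{j*}_{-\mathbf n}\Big)|0\rangle_{ab},\,P^{\mathbf E}_{ab}\Big)$$ are well defined: for each coefficient, only finitely many terms of the sum over the basis of $\mathcal F_a\otimes\mathcal F_b$ contribute to each power of $Q$. Moreover $\tilde G_{closed}$ is invertible in $S$. 3. The normalized gluing $G^{\mathbf E}(V_1,V_2)=\tilde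 G/\tilde G_{closed}$ is a Bogoliubov transform in $\mathcal F_1\otimes\cdots\otimes\mathcal F_{M+N}$, i.e. equals $\exp\big(\sum_{i,j=1}^{M+N}\sum_{m,n\ge0}R^{ij}_{mn}\psi^i_{\mathbf m}\psi^{j*}_{-\mathbf n}\big)|0\rangle$ for some $R^{ij}_{mn}\in S$. -/

import Mathlib

noncomputable section

namespace Bogoliubov

/-! Half-integers are indexed by integers throughout: the integer `n` stands for `n + 1/2`.  In
particular `ψ_{n+1/2}` has index `n`, `ψ_{-(n+1/2)}` has index `-n-1`, and the negative
half-integers are the `n < 0`. -/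

/-- Admissible sets of half-integers `A = {a₁ > a₂ > ⋯}`; the set `A` stands for the basis vector
`a₁ ∧ a₂ ∧ ⋯` of the fermionic Fock space `𝓕`. -/
@[ext]
structure AdmissibleSet where
  carrier : Set ℤ
  finite_holes : (Set.Iio 0 \ carrier).Finite
  finite_particles : (carrier \ Set.Iio 0).Finite

namespace AdmissibleSet

/-- The admissible set `{-1/2, -3/2, …}` of the vacuum. -/
def vacuum : AdmissibleSet where
  carrier := Set.Iio 0
  finite_holes := by simp
  finite_particles := by simp

/-- `A ∪ {r}`. -/
def insert (A : AdmissibleSet) (r : ℤ) : AdmissibleSet where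
  carrier := Insert.insert r A.carrier
  finite_holes := A.finite_holes.subset fun _ hx => ⟨hx.1, fun h => hx.2 (Or.inr h)⟩
  finite_particles := (A.finite_particles.insert r).subset fun _ hx =>
    hx.1.elim Or.inl fun h => Or.inr ⟨h, hx.2⟩

/-- `A \ {r}`. -/
def erase (A : AdmissibleSet) (r : ℤ) : AdmissibleSet where
  carrier := A.carrier \ {r}
  finite_holes := (A.finite_holes.insert r).subset fun x hx => by
    by_cases h : x = r
    · exact Or.inl h
    · exact Or.inr ⟨hx.1, fun h' => hx.2 ⟨h', h⟩⟩
  finite_particles := A.finite_particles.subset fun _ hx => ⟨hx.1.1, hx.2⟩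

/-- The charge: the number of particles minus the number of holes. -/
def charge (A : AdmissibleSet) : ℤ :=
  ((A.carrier \ Set.Iio 0).ncard : ℤ) - ((Set.Iio 0 \ A.carrier).ncard : ℤ)

/-- The number of elements of `A` that are greater than `r`. -/
def above (A : AdmissibleSet) (r : ℤ) : ℕ := {a ∈ A.carrier | r < a}.ncard

end AdmissibleSet

/-- Index set of the standard basis `A₁ ⊗ ⋯ ⊗ A_N` of `𝓕₁ ⊗ ⋯ ⊗ 𝓕_N`. -/
abbrev State (N : ℕ) : Type := Fin N → AdmissibleSet

/-- Vectors of the (completed) `N`-component Fock space with coefficients in `K`: formal, possibly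
infinite, linear combinations of the standard basis, given by their coefficients. -/
abbrev FockVector (K : Type*) (N : ℕ) : Type _ := State N → K

section Fock

variable {K : Type*} [CommRing K] {N : ℕ}

open Classical in
/-- The standard basis vector `A₁ ⊗ ⋯ ⊗ A_N`. -/
def basisVector (K : Type*) [CommRing K] {N : ℕ} (s : State N) : FockVector K N := Pi.single s 1

/-- The vacuum `|0⟩ ⊗ ⋯ ⊗ |0⟩`. -/
def vacuum (K : Type*) [CommRing K] (N : ℕ) : FockVector K N :=
  basisVector K fun _ => AdmissibleSet.vacuum

/-- The sign with which `ψ^i_r` or `ψ^{i*}_r` acts on a basis vector: the product of the Koszul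
sign for passing the tensor factors `j < i` and of the sign `(-1)^k`, where `k` is the number of
elements greater than `r` in the `i`-th factor. -/
def opSign (K : Type*) [CommRing K] {N : ℕ} (s : State N) (i : Fin N) (r : ℤ) : K :=
  (-1) ^ ((∑ j ∈ Finset.Iio i, (s j).charge.natAbs) + (s i).above r)

open Classical in
/-- The operator `ψ^i_r`; its values on basis vectors are given by `psi_basisVector`. -/
def psi (i : Fin N) (r : ℤ) : FockVector K N →ₗ[K] FockVector K N where
  toFun v := fun s =>
    if r ∈ (s i).carrier then opSign K s i r * v (Function.update s i ((s i).erase r)) else 0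
  map_add' v w := by
    funext s
    by_cases h : r ∈ (s i).carrier <;> simp [h, mul_add]
  map_smul' c v := by
    funext s
    by_cases h : r ∈ (s i).carrier <;> simp [h, mul_left_comm]

open Classical in
/-- The operator `ψ^{i*}_r`; its values on basis vectors are given by `psiStar_basisVector`. -/
def psiStar (i : Fin N) (r : ℤ) : FockVector K N →ₗ[K] FockVector K N where
  toFun v := fun s =>
    if r ∈ (s i).carrier then 0 else opSign K s i r * v (Function.update s i ((s i).insert r))
  map_add' v w := by
    funext s
    by_cases h : r ∈ (s i).carrier <;> simp [h, mul_add]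
  map_smul' c v := by
    funext s
    by_cases h : r ∈ (s i).carrier <;> simp [h, mul_left_comm]

theorem AdmissibleSet.erase_insert {A : AdmissibleSet} {r : ℤ} (h : r ∉ A.carrier) :
    (A.insert r).erase r = A := by
  ext x
  simp only [AdmissibleSet.insert, AdmissibleSet.erase, Set.mem_sdiff, Set.mem_insert_iff,
    Set.mem_singleton_iff]
  constructor
  · rintro ⟨h1 | h1, h2⟩
    · exact absurd h1 h2
    · exact h1
  · intro hx
    exact ⟨Or.inr hx, fun e => h (e ▸ hx)⟩

theorem AdmissibleSet.insert_erase {A : AdmissibleSet} {r : ℤ} (h : r ∈ A.carrier) :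
    (A.erase r).insert r = A := by
  ext x
  simp only [AdmissibleSet.insert, AdmissibleSet.erase, Set.mem_sdiff, Set.mem_insert_iff,
    Set.mem_singleton_iff]
  constructor
  · rintro (h1 | h1)
    · exact h1 ▸ h
    · exact h1.1
  · intro hx
    by_cases e : x = r
    · exact Or.inl e
    · exact Or.inr ⟨hx, e⟩

theorem AdmissibleSet.above_insert (A : AdmissibleSet) (r : ℤ) :
    (A.insert r).above r = A.above r := by
  unfold AdmissibleSet.above
  congr 1
  ext x
  simp only [AdmissibleSet.insert, Set.mem_ofPred_eq, Set.mem_insert_iff]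
  constructor
  · rintro ⟨h1 | h1, h2⟩
    · omega
    · exact ⟨h1, h2⟩
  · rintro ⟨h1, h2⟩
    exact ⟨Or.inr h1, h2⟩

theorem AdmissibleSet.above_erase (A : AdmissibleSet) (r : ℤ) :
    (A.erase r).above r = A.above r := by
  unfold AdmissibleSet.above
  congr 1
  ext x
  simp only [AdmissibleSet.erase, Set.mem_ofPred_eq, Set.mem_sdiff, Set.mem_singleton_iff]
  constructor
  · rintro ⟨h1, h2⟩
    exact ⟨h1.1, h2⟩
  · rintro ⟨h1, h2⟩
    exact ⟨⟨h1, by omega⟩, h2⟩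

theorem opSign_update (s : State N) (i : Fin N) (r : ℤ) (B : AdmissibleSet)
    (hB : B.above r = (s i).above r) : opSign K (Function.update s i B) i r = opSign K s i r := by
  unfold opSign
  rw [Function.update_self, hB]
  congr 2
  refine Finset.sum_congr rfl fun j hj => ?_
  rw [Function.update_of_ne (Finset.mem_Iio.1 hj).ne]

open Classical in
/-- `ψ^i_r` inserts `r` in the `i`-th factor, or gives `0` if `r` is already there. -/
theorem psi_basisVector (i : Fin N) (r : ℤ) (s : State N) :
    psi i r (basisVector K s) =
      if r ∈ (s i).carrier then 0
      else opSign K s i r • basisVector K (Function.update s i ((s i).insert r)) := by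
  funext t
  by_cases ht : r ∈ (t i).carrier
  · by_cases hs : Function.update t i ((t i).erase r) = s
    · subst hs
      have h1 : r ∉ ((t i).erase r).carrier := fun h => h.2 rfl
      simp [psi, basisVector, ht, h1, AdmissibleSet.insert_erase ht,
        opSign_update t i r _ (AdmissibleSet.above_erase _ _)]
    · have : ¬ (r ∉ (s i).carrier ∧ t = Function.update s i ((s i).insert r)) := by
        rintro ⟨h1, h2⟩
        apply hs
        rw [h2]
        simp [AdmissibleSet.erase_insert h1]
      by_cases h1 : r ∈ (s i).carrier
      · simp [psi, basisVector, ht, hs, h1]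
      · have h2 : t ≠ Function.update s i ((s i).insert r) := fun h => this ⟨h1, h⟩
        simp [psi, basisVector, ht, hs, h1, h2]
  · by_cases h1 : r ∈ (s i).carrier
    · simp [psi, ht, h1]
    · have h2 : t ≠ Function.update s i ((s i).insert r) := by
        rintro rfl
        simp [AdmissibleSet.insert] at ht
      simp [psi, basisVector, ht, h1, h2]

open Classical in
/-- `ψ^{i*}_r` removes `r` from the `i`-th factor, or gives `0` if `r` is not there. -/
theorem psiStar_basisVector (i : Fin N) (r : ℤ) (s : State N) :
    psiStar i r (basisVector K s) =
      if r ∈ (s i).carrier then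
        opSign K s i r • basisVector K (Function.update s i ((s i).erase r))
      else 0 := by
  funext t
  by_cases ht : r ∈ (t i).carrier
  · by_cases h1 : r ∈ (s i).carrier
    · have h2 : t ≠ Function.update s i ((s i).erase r) := by
        rintro rfl
        simp [AdmissibleSet.erase] at ht
      simp [psiStar, basisVector, ht, h1, h2]
    · simp [psiStar, ht, h1]
  · by_cases hs : Function.update t i ((t i).insert r) = s
    · subst hs
      have h1 : r ∈ ((t i).insert r).carrier := Or.inl rfl
      simp [psiStar, basisVector, ht, h1, AdmissibleSet.erase_insert ht,
        opSign_update t i r _ (AdmissibleSet.above_insert _ _)]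
    · by_cases h1 : r ∈ (s i).carrier
      · have h2 : t ≠ Function.update s i ((s i).erase r) := by
          intro h2
          apply hs
          rw [h2]
          simp [AdmissibleSet.insert_erase h1]
        simp [psiStar, basisVector, ht, hs, h1, h2]
      · simp [psiStar, basisVector, ht, hs, h1]

/-- The operator `∑_{i,j} ∑_{m,n ≥ 0} A^{ij}_{mn} ψ^i_{m+1/2} ψ^{j*}_{-(n+1/2)}`, computed
coefficientwise; each coefficient is a finite sum by `quadraticCreator_finite`. -/
def quadraticCreator (A : Fin N → Fin N → ℕ → ℕ → K) (v : FockVector K N) : FockVector K N :=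
  fun s => ∑ᶠ q : (Fin N × Fin N) × (ℕ × ℕ),
    A q.1.1 q.1.2 q.2.1 q.2.2 * psi q.1.1 (q.2.1 : ℤ) (psiStar q.1.2 (-(q.2.2 : ℤ) - 1) v) s

theorem psi_psiStar_ne_zero {i j : Fin N} {m n : ℕ} {v : FockVector K N} {s : State N}
    (h : psi i (m : ℤ) (psiStar j (-(n : ℤ) - 1) v) s ≠ 0) :
    (m : ℤ) ∈ (s i).carrier ∧ (-(n : ℤ) - 1) ∉ (s j).carrier ∧
      v (Function.update (Function.update s i ((s i).erase m)) j
        ((Function.update s i ((s i).erase m) j).insert (-(n : ℤ) - 1))) ≠ 0 := by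
  have h1 : (m : ℤ) ∈ (s i).carrier := by
    by_contra h1
    exact h (by simp [psi, h1])
  have h2 : (-(n : ℤ) - 1) ∉ (Function.update s i ((s i).erase m) j).carrier := by
    intro h2
    exact h (by simp [psi, psiStar, h2])
  refine ⟨h1, ?_, ?_⟩
  · intro h3
    apply h2
    by_cases e : j = i
    · subst e
      simp only [Function.update_self, AdmissibleSet.erase]
      exact ⟨h3, by simp only [Set.mem_singleton_iff]; omega⟩
    · rwa [Function.update_of_ne e]
  · intro h3
    exact h (by simp [psi, psiStar, h3])

theorem quadraticCreator_finite (A : Fin N → Fin N → ℕ → ℕ → K) (v : FockVector K N)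
    (s : State N) :
    (Function.support fun q : (Fin N × Fin N) × (ℕ × ℕ) => A q.1.1 q.1.2 q.2.1 q.2.2 *
      psi q.1.1 (q.2.1 : ℤ) (psiStar q.1.2 (-(q.2.2 : ℤ) - 1) v) s).Finite := by
  have hp : (⋃ i, {m : ℕ | (m : ℤ) ∈ (s i).carrier}).Finite := by
    refine Set.finite_iUnion fun i => ?_
    refine ((s i).finite_particles.preimage (f := fun m : ℕ => (m : ℤ))
      (fun a _ b _ hab => by simpa using hab)).subset fun m hm => ?_
    exact ⟨hm, by simp⟩
  have hh : (⋃ j, {n : ℕ | (-(n : ℤ) - 1) ∉ (s j).carrier}).Finite := by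
    refine Set.finite_iUnion fun j => ?_
    refine ((s j).finite_holes.preimage (f := fun n : ℕ => -(n : ℤ) - 1)
      (fun a _ b _ hab => by simp only at hab; omega)).subset fun n hn => ?_
    exact ⟨by simp only [Set.mem_Iio]; omega, hn⟩
  refine ((Set.finite_univ (α := Fin N × Fin N)).prod (hp.prod hh)).subset fun q hq => ?_
  obtain ⟨h1, h2, -⟩ := psi_psiStar_ne_zero (right_ne_zero_of_mul hq)
  exact ⟨trivial, Set.mem_iUnion.2 ⟨_, h1⟩, Set.mem_iUnion.2 ⟨_, h2⟩⟩

/-- The number of particles of a state. -/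
def particles (s : State N) : ℕ := ∑ i, ((s i).carrier \ Set.Iio 0).ncard

theorem iterate_quadraticCreator_vacuum (A : Fin N → Fin N → ℕ → ℕ → K) (k : ℕ) (s : State N)
    (h : ((quadraticCreator A)^[k] (vacuum K N)) s ≠ 0) : particles s = k := by
  induction k generalizing s with
  | zero =>
    have : s = fun _ => AdmissibleSet.vacuum := by
      by_contra hs
      exact h (by simp [vacuum, basisVector, hs])
    subst this
    simp [particles, AdmissibleSet.vacuum]
  | succ k ih =>
    rw [Function.iterate_succ_apply'] at h
    obtain ⟨q, hq⟩ : ∃ q : (Fin N × Fin N) × (ℕ × ℕ), A q.1.1 q.1.2 q.2.1 q.2.2 *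
        psi q.1.1 (q.2.1 : ℤ) (psiStar q.1.2 (-(q.2.2 : ℤ) - 1)
          ((quadraticCreator A)^[k] (vacuum K N))) s ≠ 0 := by
      by_contra hc
      push Not at hc
      exact h (by simp only [quadraticCreator, hc, finsum_zero])
    obtain ⟨h1, -, h3⟩ := psi_psiStar_ne_zero (right_ne_zero_of_mul hq)
    rw [← ih _ h3]
    set s' := Function.update s q.1.1 ((s q.1.1).erase q.2.1) with hs'
    have e1 : particles (Function.update s' q.1.2 ((s' q.1.2).insert (-(q.2.2 : ℤ) - 1))) =
        particles s' := by
      unfold particles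
      refine Finset.sum_congr rfl fun i _ => ?_
      by_cases e : i = q.1.2
      · subst e
        rw [Function.update_self]
        congr 1
        ext x
        simp only [AdmissibleSet.insert, Set.mem_sdiff, Set.mem_insert_iff, Set.mem_Iio]
        constructor
        · rintro ⟨h | h, h'⟩
          · omega
          · exact ⟨h, h'⟩
        · rintro ⟨h, h'⟩
          exact ⟨Or.inr h, h'⟩
      · rw [Function.update_of_ne e]
    rw [e1]
    unfold particles
    rw [← Finset.add_sum_erase _ _ (Finset.mem_univ q.1.1),
      ← Finset.add_sum_erase _ _ (Finset.mem_univ q.1.1)]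
    have e2 : ∑ x ∈ Finset.univ.erase q.1.1, ((s' x).carrier \ Set.Iio 0).ncard =
        ∑ x ∈ Finset.univ.erase q.1.1, ((s x).carrier \ Set.Iio 0).ncard := by
      refine Finset.sum_congr rfl fun i hi => ?_
      rw [hs', Function.update_of_ne (Finset.ne_of_mem_erase hi)]
    have e3 : (s' q.1.1).carrier \ Set.Iio 0 =
        ((s q.1.1).carrier \ Set.Iio 0) \ {(q.2.1 : ℤ)} := by
      rw [hs', Function.update_self]
      ext x
      simp only [AdmissibleSet.erase, Set.mem_sdiff]
      tauto
    rw [e2, e3, ← Set.ncard_sdiff_singleton_add_one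
      (show (q.2.1 : ℤ) ∈ (s q.1.1).carrier \ Set.Iio 0 from ⟨h1, by simp⟩)
      (s q.1.1).finite_particles]
    omega

variable [Algebra ℚ K]

/-- The vector `exp (∑_{i,j} ∑_{m,n ≥ 0} A^{ij}_{mn} ψ^i_{m+1/2} ψ^{j*}_{-(n+1/2)}) |0⟩`, with the
exponential series computed coefficientwise; each coefficient is a finite sum by
`bogoliubov_finite`. -/
def bogoliubov (A : Fin N → Fin N → ℕ → ℕ → K) : FockVector K N :=
  fun s => ∑ᶠ k : ℕ, ((k.factorial : ℚ)⁻¹) • ((quadraticCreator A)^[k] (vacuum K N)) s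

theorem bogoliubov_finite (A : Fin N → Fin N → ℕ → ℕ → K) (s : State N) :
    (Function.support fun k : ℕ =>
      ((k.factorial : ℚ)⁻¹) • ((quadraticCreator A)^[k] (vacuum K N)) s).Finite := by
  refine (Set.finite_singleton (particles s)).subset fun k hk => ?_
  have : ((quadraticCreator A)^[k] (vacuum K N)) s ≠ 0 := by
    intro h0
    exact hk (by simp [h0])
  exact (iterate_quadraticCreator_vacuum A k s this).symm

/-- `V` is a Bogoliubov transform (of the vacuum). -/
def IsBogoliubov (V : FockVector K N) : Prop :=
  ∃ A : Fin N → Fin N → ℕ → ℕ → K, V = bogoliubov A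

end Fock

section Gluing

variable {R : Type*} [CommRing R]

/-- The ring `R[Θ, Θ⁻¹]⟦Q⟧` of formal power series in `Q` whose coefficients are Laurent polynomials
in `Θ`. -/
abbrev GluingRing (R : Type*) [CommRing R] : Type _ := PowerSeries (LaurentPolynomial R)

/-- The monomial `Q ^ k Θ ^ e`. -/
def monomialQΘ (R : Type*) [CommRing R] (k : ℕ) (e : ℤ) : GluingRing R :=
  PowerSeries.monomial k (LaurentPolynomial.T e)

/-- The exponent `ε^{ab}_{ij}`; the index `0` stands for `a` and `1` for `b`. -/
def gluingExponent (i j : Fin 2) : ℤ :=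
  if i = 0 ∧ j = 1 then 1 else if i = 1 ∧ j = 0 then -1 else 0

/-- The gluing vector `P^E_{ab}` in `𝓕_a ⊗ 𝓕_b`. -/
def gluingVector [Algebra ℚ R] (E : Fin 2 → Fin 2 → ℕ → ℕ → GluingRing R) :
    FockVector (GluingRing R) 2 :=
  bogoliubov fun i j m n => monomialQΘ R (m + n + 1) (gluingExponent i j) * E i j m n

/-- The `Q`-adic convergence of the infinite sum that defines the inner product `(v, w)`: only
finitely many terms contribute to each power of `Q`. -/
def InnerConverges {N : ℕ} (v w : FockVector (GluingRing R) N) : Prop :=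
  ∀ d : ℕ, {t : State N | PowerSeries.coeff d (v t * w t) ≠ 0}.Finite

/-- The bilinear inner product for which the standard basis is orthonormal, summed `Q`-adically. -/
def innerProduct {N : ℕ} (v w : FockVector (GluingRing R) N) : GluingRing R :=
  PowerSeries.mk fun d => ∑ᶠ t : State N, PowerSeries.coeff d (v t * w t)

/-- The vector in `𝓕_a ⊗ 𝓕_b` that is the coefficient in `V ∈ 𝓕₁ ⊗ ⋯ ⊗ 𝓕_M ⊗ 𝓕_a ⊗ 𝓕_b` of the
basis vector `s` of `𝓕₁ ⊗ ⋯ ⊗ 𝓕_M`. -/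
def slice {M : ℕ} (V : FockVector (GluingRing R) (M + 2)) (s : State M) :
    FockVector (GluingRing R) 2 :=
  fun t => V (Fin.append s t)

variable [Algebra ℚ R]

/-- The self-gluing `(V, P^E_{ab})`: the inner product over the last two components `a`, `b`. -/
def selfGluing {M : ℕ} (E : Fin 2 → Fin 2 → ℕ → ℕ → GluingRing R)
    (V : FockVector (GluingRing R) (M + 2)) : FockVector (GluingRing R) M :=
  fun s => innerProduct (slice V s) (gluingVector E)

/-- The part `exp (∑_{i,j ∈ {a,b}} ∑_{m,n} A^{ij}_{mn} ψ^i ψ^{j*}) |0⟩_{ab}` of the Bogoliubov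
transform with coefficients `A`. -/
def closedVector {M : ℕ} (A : Fin (M + 2) → Fin (M + 2) → ℕ → ℕ → GluingRing R) :
    FockVector (GluingRing R) 2 :=
  bogoliubov fun i j => A (Fin.natAdd M i) (Fin.natAdd M j)

/-- The closed part of the self-gluing of the Bogoliubov transform with coefficients `A`. -/
def selfGluingClosed {M : ℕ} (E : Fin 2 → Fin 2 → ℕ → ℕ → GluingRing R)
    (A : Fin (M + 2) → Fin (M + 2) → ℕ → ℕ → GluingRing R) : GluingRing R :=
  innerProduct (closedVector A) (gluingVector E)

/-- The normalized self-gluing of the Bogoliubov transform `V` with coefficients `A`: the quotient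
of the self-gluing by its closed part. -/
def normalizedSelfGluing {M : ℕ} (E : Fin 2 → Fin 2 → ℕ → ℕ → GluingRing R)
    (A : Fin (M + 2) → Fin (M + 2) → ℕ → ℕ → GluingRing R)
    (V : FockVector (GluingRing R) (M + 2)) : FockVector (GluingRing R) M :=
  fun s => selfGluing E V s * Ring.inverse (selfGluingClosed E A)

end Gluing

section Tensor

variable {K : Type*} [CommRing K] {M N : ℕ}

/-- The positions of the components `1, …, M, a` among `1, …, M + N, a, b`. -/
def leftSlot (M N : ℕ) : Fin (M + 1) → Fin (M + N + 2) :=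
  Fin.append (fun i : Fin M => Fin.castAdd 2 (Fin.castAdd N i))
    (fun _ : Fin 1 => Fin.natAdd (M + N) (0 : Fin 2))

/-- The positions of the components `M + 1, …, M + N, b` among `1, …, M + N, a, b`. -/
def rightSlot (M N : ℕ) : Fin (N + 1) → Fin (M + N + 2) :=
  Fin.append (fun j : Fin N => Fin.castAdd 2 (Fin.natAdd M j))
    (fun _ : Fin 1 => Fin.natAdd (M + N) (1 : Fin 2))

/-- The tensor product of `V₁ ∈ 𝓕₁ ⊗ ⋯ ⊗ 𝓕_M ⊗ 𝓕_a` and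
`V₂ ∈ 𝓕_{M+1} ⊗ ⋯ ⊗ 𝓕_{M+N} ⊗ 𝓕_b` as a vector in `𝓕₁ ⊗ ⋯ ⊗ 𝓕_{M+N} ⊗ 𝓕_a ⊗ 𝓕_b`, with the Koszul
sign for moving `𝓕_a` past `𝓕_{M+1} ⊗ ⋯ ⊗ 𝓕_{M+N}`. -/
def tensor (V₁ : FockVector K (M + 1)) (V₂ : FockVector K (N + 1)) : FockVector K (M + N + 2) :=
  fun s =>
    (-1) ^ ((s (Fin.natAdd (M + N) (0 : Fin 2))).charge.natAbs *
        ∑ j : Fin N, (s (Fin.castAdd 2 (Fin.natAdd M j))).charge.natAbs) *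
      (V₁ (s ∘ leftSlot M N) * V₂ (s ∘ rightSlot M N))

/-- For each of the components `1, …, M + N, a, b`, its place among `1, …, M, a` or among
`M + 1, …, M + N, b`. -/
def splitSlot (M N : ℕ) : Fin (M + N + 2) → Fin (M + 1) ⊕ Fin (N + 1) :=
  Fin.append
    (Fin.append (fun i : Fin M => Sum.inl i.castSucc) (fun j : Fin N => Sum.inr j.castSucc))
    ![Sum.inl (Fin.last M), Sum.inr (Fin.last N)]

/-- The coefficients `A^{ij}_{mn}`, `i, j ∈ {1, …, M + N, a, b}`, that extend `A₁` and `A₂` by zero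
if `i` and `j` are not both in `{1, …, M, a}` or both in `{M + 1, …, M + N, b}`. -/
def tensorCoeff (A₁ : Fin (M + 1) → Fin (M + 1) → ℕ → ℕ → K)
    (A₂ : Fin (N + 1) → Fin (N + 1) → ℕ → ℕ → K) :
    Fin (M + N + 2) → Fin (M + N + 2) → ℕ → ℕ → K :=
  fun p q m n =>
    match splitSlot M N p, splitSlot M N q with
    | Sum.inl i, Sum.inl j => A₁ i j m n
    | Sum.inr i, Sum.inr j => A₂ i j m n
    | _, _ => 0

end Tensor

/-- The normalized gluing of the Bogoliubov transforms `V₁` and `V₂` with coefficients `A₁` and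
`A₂`: the normalized self-gluing of `V₁ ⊗ V₂`. -/
def normalizedGluing {R : Type*} [CommRing R] [Algebra ℚ R] {M N : ℕ}
    (E : Fin 2 → Fin 2 → ℕ → ℕ → GluingRing R)
    (A₁ : Fin (M + 1) → Fin (M + 1) → ℕ → ℕ → GluingRing R)
    (A₂ : Fin (N + 1) → Fin (N + 1) → ℕ → ℕ → GluingRing R)
    (V₁ : FockVector (GluingRing R) (M + 1)) (V₂ : FockVector (GluingRing R) (N + 1)) :
    FockVector (GluingRing R) (M + N) :=
  normalizedSelfGluing E (tensorCoeff A₁ A₂) (tensor V₁ V₂)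

end Bogoliubov

end

noncomputable section

namespace Bogoliubov

/-! ### Charge and counting of occupied modes in one factor. -/

namespace AdmissibleSet

/-! A Bogoliubov transform is handled through linear equations instead of its exponential series.
Commuting `ψ^{i*}_{m+1/2}`, which kills the vacuum, past the exponential gives the contraction
identities `ψ^{i*}_{m+1/2} V = ∑ A^{ij}_{mn} ψ^{j*}_{-(n+1/2)} V` (`psiStar_bogoliubov`).
Conversely, among vectors of total charge zero these identities determine `V` up to its vacuum
coefficient: they express each coefficient through coefficients of states with fewer particles
(`eq_of_contractHoles`, `eq_smul_bogoliubov`, `eq_bogoliubov`). To recognize a Bogoliubov transform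
it is therefore enough to check charge, vacuum coefficient and contraction identities. Base change
(`map_bogoliubov`), the tensor product (`tensor_bogoliubov`) and restriction to the vacuum of some
factors (`bogoliubov_append_vacuum`) are all treated in this way.

For the gluing, work modulo `Q ^ d`. The factor `Q^{m+n+1}` kills all coefficients of `P^E_{ab}`
with `m ≥ d` or `n ≥ d`, so `P^E_{ab}` is supported on finitely many states and the inner product is
a finite sum. This also gives the `Q`-adic convergence. Pairing the contraction identities of `V`
with `P^E_{ab}` leaves the pairings of `ψ^*_{-(n+1/2)} V`, for `ψ^*` on `a` and `b`, as unknowns. By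
adjointness and the identity `psi_bogoliubov` for `P^E_{ab}` they satisfy a finite linear system
with matrix `1 + Eᵀ A`. This matrix is `1` modulo `Q`, hence invertible. Eliminating the unknowns
yields contraction identities for the glued vector (`exists_contractHoles_pairing`), which is thus
its vacuum coefficient times a Bogoliubov transform. The vacuum coefficient is the closed part, a
unit because its constant term in `Q` is `1`.

Finally the coefficients of a Bogoliubov transform can be read off from the vector by a formula
compatible with ring homomorphisms (`coeff_eq_of_bogoliubov`). Applied to the normalized gluing over
the full ring, this formula gives coefficients that are correct modulo every `Q ^ d`, hence correct.
-/

@[simp] theorem mem_insert {A : AdmissibleSet} {r x : ℤ} :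
    x ∈ (A.insert r).carrier ↔ x = r ∨ x ∈ A.carrier := Iff.rfl

@[simp] theorem mem_erase {A : AdmissibleSet} {r x : ℤ} :
    x ∈ (A.erase r).carrier ↔ x ∈ A.carrier ∧ x ≠ r := Iff.rfl

@[simp] theorem mem_vacuum {x : ℤ} : x ∈ vacuum.carrier ↔ x < 0 := Iff.rfl

theorem charge_insert {A : AdmissibleSet} {r : ℤ} (h : r ∉ A.carrier) :
    (A.insert r).charge = A.charge + 1 := by
  unfold charge
  by_cases hr : r < 0
  · have h1 : (A.insert r).carrier \ Set.Iio 0 = A.carrier \ Set.Iio 0 := by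
      ext x
      simp only [Set.mem_sdiff, mem_insert, Set.mem_Iio]
      constructor
      · rintro ⟨rfl | h1, h2⟩
        · exact absurd hr h2
        · exact ⟨h1, h2⟩
      · tauto
    have h2 : Set.Iio 0 \ (A.insert r).carrier = (Set.Iio 0 \ A.carrier) \ {r} := by
      ext x
      simp only [Set.mem_sdiff, mem_insert, Set.mem_Iio, Set.mem_singleton_iff]
      tauto
    have h3 := Set.ncard_sdiff_singleton_add_one
      (show r ∈ Set.Iio 0 \ A.carrier from ⟨hr, h⟩) A.finite_holes
    rw [h1, h2]
    omega
  · have h1 : (A.insert r).carrier \ Set.Iio 0 = Insert.insert r (A.carrier \ Set.Iio 0) := by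
      ext x
      simp only [Set.mem_sdiff, mem_insert, Set.mem_Iio, Set.mem_insert_iff]
      constructor
      · tauto
      · rintro (rfl | h1)
        · exact ⟨Or.inl rfl, hr⟩
        · exact ⟨Or.inr h1.1, h1.2⟩
    have h2 : Set.Iio 0 \ (A.insert r).carrier = Set.Iio 0 \ A.carrier := by
      ext x
      simp only [Set.mem_sdiff, mem_insert, Set.mem_Iio]
      constructor
      · tauto
      · rintro ⟨hx, h2⟩
        refine ⟨hx, ?_⟩
        rintro (rfl | h3)
        · exact hr hx
        · exact h2 h3
    rw [h1, h2, Set.ncard_insert_of_notMem (fun h' => h h'.1) A.finite_particles]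
    push_cast
    ring

theorem charge_erase {A : AdmissibleSet} {r : ℤ} (h : r ∈ A.carrier) :
    (A.erase r).charge = A.charge - 1 := by
  have h1 := charge_insert (A := A.erase r) (r := r) (fun h' => h'.2 rfl)
  rw [insert_erase h] at h1
  omega

@[simp] theorem charge_vacuum : vacuum.charge = 0 := by simp [charge, vacuum]

theorem finite_above (A : AdmissibleSet) (r : ℤ) : {a ∈ A.carrier | r < a}.Finite := by
  refine (A.finite_particles.union (Set.finite_Ioo r 0)).subset fun x hx => ?_
  by_cases h : x < 0
  · exact Or.inr ⟨hx.2, h⟩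
  · exact Or.inl ⟨hx.1, h⟩

theorem above_insert_of_lt {A : AdmissibleSet} {q r : ℤ} (h : q ∉ A.carrier) (hq : r < q) :
    (A.insert q).above r = A.above r + 1 := by
  unfold above
  rw [← Set.ncard_insert_of_notMem (fun h' => h h'.1) (A.finite_above r)]
  congr 1
  ext x
  simp only [Set.mem_ofPred_eq, mem_insert, Set.mem_insert_iff]
  constructor
  · tauto
  · rintro (rfl | h1)
    · exact ⟨Or.inl rfl, hq⟩
    · exact ⟨Or.inr h1.1, h1.2⟩

theorem above_insert_of_le (A : AdmissibleSet) {q r : ℤ} (hq : q ≤ r) :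
    (A.insert q).above r = A.above r := by
  unfold above
  congr 1
  ext x
  simp only [Set.mem_ofPred_eq, mem_insert]
  constructor
  · rintro ⟨rfl | h1, h2⟩
    · omega
    · exact ⟨h1, h2⟩
  · tauto

end AdmissibleSet

/-! ### Adding and removing modes, and the resulting changes of sign and charge. -/

section Signs

variable {K : Type*} [CommRing K] {N : ℕ}

/-- The sign `(-1)^c` for an integer `c`. -/
def intSign (K : Type*) [CommRing K] (c : ℤ) : K := (-1) ^ c.natAbs

theorem intSign_eq (c : ℤ) : intSign K c = if Even c then 1 else -1 := by
  unfold intSign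
  split_ifs with h
  · exact (Int.natAbs_even.2 h).neg_one_pow
  · exact (Int.natAbs_odd.2 (Int.not_even_iff_odd.1 h)).neg_one_pow

@[simp] theorem intSign_zero : intSign K 0 = 1 := by simp [intSign]

theorem intSign_add_one (c : ℤ) : intSign K (c + 1) = -intSign K c := by
  simp only [intSign_eq, Int.even_add_one]
  split_ifs <;> simp

theorem intSign_mul_self (c : ℤ) : intSign K c * intSign K c = 1 := by
  rw [intSign, ← mul_pow]; simp

/-- `s` with `r` added to the `i`-th factor. -/
def addMode (s : State N) (i : Fin N) (r : ℤ) : State N := Function.update s i ((s i).insert r)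

/-- `s` with `r` removed from the `i`-th factor. -/
def removeMode (s : State N) (i : Fin N) (r : ℤ) : State N := Function.update s i ((s i).erase r)

theorem mem_addMode {s : State N} {i j : Fin N} {r q : ℤ} :
    q ∈ (addMode s i r j).carrier ↔ (j = i ∧ q = r) ∨ q ∈ (s j).carrier := by
  unfold addMode
  by_cases h : j = i
  · subst h; simp
  · simp [h]

theorem mem_removeMode {s : State N} {i j : Fin N} {r q : ℤ} :
    q ∈ (removeMode s i r j).carrier ↔ q ∈ (s j).carrier ∧ ¬ (j = i ∧ q = r) := by
  unfold removeMode
  by_cases h : j = i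
  · subst h; simp
  · simp [h]

theorem State.ext_mem {s t : State N} (h : ∀ i r, r ∈ (s i).carrier ↔ r ∈ (t i).carrier) :
    s = t := by
  funext i
  ext r
  exact h i r

theorem addMode_removeMode {s : State N} {i : Fin N} {r : ℤ} (h : r ∈ (s i).carrier) :
    addMode (removeMode s i r) i r = s :=
  State.ext_mem fun j q => by
    rw [mem_addMode, mem_removeMode]
    constructor
    · rintro (⟨rfl, rfl⟩ | h1)
      · exact h
      · exact h1.1
    · tauto

theorem removeMode_addMode {s : State N} {i : Fin N} {r : ℤ} (h : r ∉ (s i).carrier) :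
    removeMode (addMode s i r) i r = s :=
  State.ext_mem fun j q => by
    rw [mem_removeMode, mem_addMode]
    constructor
    · tauto
    · intro h1
      refine ⟨Or.inr h1, ?_⟩
      rintro ⟨rfl, rfl⟩
      exact h h1

theorem addMode_comm (s : State N) (i j : Fin N) (r q : ℤ) :
    addMode (addMode s i r) j q = addMode (addMode s j q) i r :=
  State.ext_mem fun k x => by simp only [mem_addMode]; tauto

theorem removeMode_comm (s : State N) (i j : Fin N) (r q : ℤ) :
    removeMode (removeMode s i r) j q = removeMode (removeMode s j q) i r :=
  State.ext_mem fun k x => by simp only [mem_removeMode]; tauto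

theorem removeMode_addMode_comm (s : State N) {i j : Fin N} {r q : ℤ} (h : ¬ (j = i ∧ q = r)) :
    removeMode (addMode s i r) j q = addMode (removeMode s j q) i r :=
  State.ext_mem fun k x => by
    simp only [mem_addMode, mem_removeMode]
    constructor
    · tauto
    · rintro (⟨rfl, rfl⟩ | h1)
      · exact ⟨Or.inl ⟨rfl, rfl⟩, fun h' => h ⟨h'.1.symm, h'.2.symm⟩⟩
      · tauto

/-- The sign by which adding the mode `(j, q)` changes the sign of the mode `(i, r)`. -/
def crossSign (K : Type*) [CommRing K] (j : Fin N) (q : ℤ) (i : Fin N) (r : ℤ) : K :=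
  if j < i ∨ (j = i ∧ r < q) then -1 else 1

theorem crossSign_mul_self (j : Fin N) (q : ℤ) (i : Fin N) (r : ℤ) :
    crossSign K j q i r * crossSign K j q i r = 1 := by
  unfold crossSign; split_ifs <;> simp

theorem crossSign_self (i : Fin N) (r : ℤ) : crossSign K i r i r = 1 := by
  simp [crossSign]

/-- Modes are totally ordered, by factor and then by decreasing half-integer, so exactly one of two
distinct modes sees the other. All anticommutation relations below come from this antisymmetry. -/
theorem crossSign_swap {i j : Fin N} {r q : ℤ} (h : ¬ (j = i ∧ q = r)) :
    crossSign K i r j q = -crossSign K j q i r := by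
  unfold crossSign
  rcases lt_trichotomy i j with h1 | h1 | h1
  · simp [h1, h1.not_gt, h1.ne']
  · subst h1
    rcases lt_trichotomy r q with h2 | h2 | h2
    · simp [h2, h2.not_gt]
    · exact absurd ⟨rfl, h2.symm⟩ h
    · simp [h2, h2.not_gt]
  · simp [h1, h1.not_gt, h1.ne']

theorem opSign_eq (s : State N) (i : Fin N) (r : ℤ) :
    opSign K s i r = (∏ j ∈ Finset.Iio i, intSign K (s j).charge) * (-1) ^ (s i).above r := by
  rw [opSign, pow_add, ← Finset.prod_pow_eq_pow_sum]
  rfl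

theorem opSign_mul_self (s : State N) (i : Fin N) (r : ℤ) :
    opSign K s i r * opSign K s i r = 1 := by
  rw [opSign, ← mul_pow]; simp

/-- A new mode in an earlier factor changes that charge by one and flips the Koszul sign. In the
same factor it matters only if it lies above `r`, and in a later factor not at all. -/
theorem opSign_addMode {s : State N} {j : Fin N} {q : ℤ} (h : q ∉ (s j).carrier) (i : Fin N)
    (r : ℤ) : opSign K (addMode s j q) i r = crossSign K j q i r * opSign K s i r := by
  rw [opSign_eq, opSign_eq]
  unfold crossSign addMode
  rcases lt_trichotomy j i with h1 | h1 | h1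
  · rw [if_pos (Or.inl h1), Function.update_of_ne h1.ne',
      ← Finset.mul_prod_erase _ _ (Finset.mem_Iio.2 h1),
      ← Finset.mul_prod_erase _ _ (Finset.mem_Iio.2 h1), Function.update_self,
      AdmissibleSet.charge_insert h, intSign_add_one]
    rw [Finset.prod_congr rfl fun k hk => by
      rw [Function.update_of_ne (Finset.ne_of_mem_erase hk)]]
    ring
  · subst h1
    rw [Function.update_self, Finset.prod_congr rfl fun k hk => by
      rw [Function.update_of_ne (Finset.mem_Iio.1 hk).ne]]
    by_cases h2 : r < q
    · rw [if_pos (Or.inr ⟨rfl, h2⟩), AdmissibleSet.above_insert_of_lt h h2]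
      ring
    · rw [if_neg (by simp [h2]), AdmissibleSet.above_insert_of_le _ (not_lt.1 h2), one_mul]
  · rw [if_neg (by simp [h1.not_gt, h1.ne']), Function.update_of_ne h1.ne, one_mul,
      Finset.prod_congr rfl fun k hk => by
        rw [Function.update_of_ne ((Finset.mem_Iio.1 hk).trans h1).ne]]

theorem opSign_removeMode {s : State N} {j : Fin N} {q : ℤ} (h : q ∈ (s j).carrier) (i : Fin N)
    (r : ℤ) : opSign K (removeMode s j q) i r = crossSign K j q i r * opSign K s i r := by
  have h1 : q ∉ (removeMode s j q j).carrier := by simp [mem_removeMode]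
  have h2 := opSign_addMode (K := K) h1 i r
  rw [addMode_removeMode h] at h2
  rw [h2, ← mul_assoc, crossSign_mul_self, one_mul]

/-- The total charge of a state. -/
def totalCharge (s : State N) : ℤ := ∑ i, (s i).charge

theorem totalCharge_update (s : State N) (i : Fin N) (B : AdmissibleSet) :
    totalCharge (Function.update s i B) = totalCharge s + (B.charge - (s i).charge) := by
  unfold totalCharge
  rw [← Finset.add_sum_erase _ _ (Finset.mem_univ i), Function.update_self,
    ← Finset.add_sum_erase (a := i) Finset.univ (fun i => (s i).charge) (Finset.mem_univ i)]
  rw [Finset.sum_congr rfl fun k hk => by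
      rw [Function.update_of_ne (Finset.ne_of_mem_erase hk)]]
  ring

theorem totalCharge_addMode {s : State N} {i : Fin N} {r : ℤ} (h : r ∉ (s i).carrier) :
    totalCharge (addMode s i r) = totalCharge s + 1 := by
  rw [addMode, totalCharge_update, AdmissibleSet.charge_insert h]; ring

theorem totalCharge_removeMode {s : State N} {i : Fin N} {r : ℤ} (h : r ∈ (s i).carrier) :
    totalCharge (removeMode s i r) = totalCharge s - 1 := by
  rw [removeMode, totalCharge_update, AdmissibleSet.charge_erase h]; ring

end Signs

/-! ### The canonical anticommutation relations. -/

section Operators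

variable {K : Type*} [CommRing K] {N : ℕ}

theorem psi_of_mem {s : State N} {i : Fin N} {r : ℤ} (h : r ∈ (s i).carrier)
    (v : FockVector K N) : psi i r v s = opSign K s i r * v (removeMode s i r) := by
  simp [psi, h, removeMode]

theorem psi_of_notMem {s : State N} {i : Fin N} {r : ℤ} (h : r ∉ (s i).carrier)
    (v : FockVector K N) : psi i r v s = 0 := by
  simp [psi, h]

theorem psiStar_of_mem {s : State N} {i : Fin N} {r : ℤ} (h : r ∈ (s i).carrier)
    (v : FockVector K N) : psiStar i r v s = 0 := by
  simp [psiStar, h]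

theorem psiStar_of_notMem {s : State N} {i : Fin N} {r : ℤ} (h : r ∉ (s i).carrier)
    (v : FockVector K N) : psiStar i r v s = opSign K s i r * v (addMode s i r) := by
  simp [psiStar, h, addMode]

theorem psi_psi (i j : Fin N) (r q : ℤ) (v : FockVector K N) :
    psi i r (psi j q v) = -psi j q (psi i r v) := by
  funext s
  rw [Pi.neg_apply]
  by_cases he : j = i ∧ q = r
  · obtain ⟨rfl, rfl⟩ := he
    have h0 : psi j q (psi j q v) s = 0 := by
      by_cases h : q ∈ (s j).carrier
      · rw [psi_of_mem h, psi_of_notMem (by simp [mem_removeMode]), mul_zero]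
      · rw [psi_of_notMem h]
    rw [h0, neg_zero]
  by_cases h1 : r ∈ (s i).carrier
  · by_cases h2 : q ∈ (s j).carrier
    · have h3 : q ∈ (removeMode s i r j).carrier := mem_removeMode.2 ⟨h2, he⟩
      have h4 : r ∈ (removeMode s j q i).carrier :=
        mem_removeMode.2 ⟨h1, fun h' => he ⟨h'.1.symm, h'.2.symm⟩⟩
      rw [psi_of_mem h1, psi_of_mem h2, psi_of_mem h3, psi_of_mem h4, opSign_removeMode h1,
        opSign_removeMode h2, removeMode_comm, crossSign_swap he]
      ring
    · rw [psi_of_notMem h2, psi_of_mem h1, psi_of_notMem (fun h => h2 (mem_removeMode.1 h).1)]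
      simp
  · rw [psi_of_notMem h1]
    by_cases h2 : q ∈ (s j).carrier
    · rw [psi_of_mem h2, psi_of_notMem (fun h => h1 (mem_removeMode.1 h).1)]
      simp
    · rw [psi_of_notMem h2]; simp

theorem psiStar_psiStar (i j : Fin N) (r q : ℤ) (v : FockVector K N) :
    psiStar i r (psiStar j q v) = -psiStar j q (psiStar i r v) := by
  funext s
  rw [Pi.neg_apply]
  by_cases he : j = i ∧ q = r
  · obtain ⟨rfl, rfl⟩ := he
    have h0 : psiStar j q (psiStar j q v) s = 0 := by
      by_cases h : q ∈ (s j).carrier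
      · rw [psiStar_of_mem h]
      · rw [psiStar_of_notMem h, psiStar_of_mem (by simp [mem_addMode]), mul_zero]
    rw [h0, neg_zero]
  by_cases h1 : r ∈ (s i).carrier
  · rw [psiStar_of_mem h1]
    by_cases h2 : q ∈ (s j).carrier
    · rw [psiStar_of_mem h2]; simp
    · rw [psiStar_of_notMem h2, psiStar_of_mem (mem_addMode.2 (Or.inr h1))]
      simp
  · by_cases h2 : q ∈ (s j).carrier
    · rw [psiStar_of_mem h2, psiStar_of_notMem h1, psiStar_of_mem (mem_addMode.2 (Or.inr h2))]
      simp
    · have h3 : q ∉ (addMode s i r j).carrier := fun h => (mem_addMode.1 h).elim he h2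
      have h4 : r ∉ (addMode s j q i).carrier := fun h =>
        (mem_addMode.1 h).elim (fun h' => he ⟨h'.1.symm, h'.2.symm⟩) h1
      rw [psiStar_of_notMem h1, psiStar_of_notMem h2, psiStar_of_notMem h3, psiStar_of_notMem h4,
        opSign_addMode h1, opSign_addMode h2, addMode_comm, crossSign_swap he]
      ring

theorem psiStar_psi_of_ne {i j : Fin N} {r q : ℤ} (he : ¬ (j = i ∧ q = r))
    (v : FockVector K N) : psiStar i r (psi j q v) = -psi j q (psiStar i r v) := by
  funext s
  rw [Pi.neg_apply]
  have he' : ¬ (i = j ∧ r = q) := fun h' => he ⟨h'.1.symm, h'.2.symm⟩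
  by_cases h1 : r ∈ (s i).carrier
  · rw [psiStar_of_mem h1]
    by_cases h2 : q ∈ (s j).carrier
    · rw [psi_of_mem h2, psiStar_of_mem (mem_removeMode.2 ⟨h1, he'⟩)]
      simp
    · rw [psi_of_notMem h2]; simp
  · rw [psiStar_of_notMem h1]
    by_cases h2 : q ∈ (s j).carrier
    · have h4 : r ∉ (removeMode s j q i).carrier := fun h => h1 (mem_removeMode.1 h).1
      rw [psi_of_mem h2, psi_of_mem (mem_addMode.2 (Or.inr h2)), psiStar_of_notMem h4,
        opSign_addMode h1, opSign_removeMode h2, removeMode_addMode_comm _ he, crossSign_swap he]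
      ring
    · rw [psi_of_notMem h2, psi_of_notMem fun h => (mem_addMode.1 h).elim he h2]
      simp

theorem psiStar_psi_self (i : Fin N) (r : ℤ) (v : FockVector K N) :
    psiStar i r (psi i r v) = v - psi i r (psiStar i r v) := by
  funext s
  rw [Pi.sub_apply]
  by_cases h1 : r ∈ (s i).carrier
  · have h2 : r ∉ (removeMode s i r i).carrier := by simp [mem_removeMode]
    rw [psiStar_of_mem h1, psi_of_mem h1, psiStar_of_notMem h2, addMode_removeMode h1,
      opSign_removeMode h1, crossSign_self, one_mul, ← mul_assoc, opSign_mul_self]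
    simp
  · have h2 : r ∈ (addMode s i r i).carrier := by simp [mem_addMode]
    rw [psiStar_of_notMem h1, psi_of_notMem h1, psi_of_mem h2, removeMode_addMode h1,
      opSign_addMode h1, crossSign_self, one_mul, ← mul_assoc, opSign_mul_self]
    simp

end Operators

/-! ### States supported in a finite window of modes. -/

section Bounded

variable {N : ℕ}

/-- All particles and holes of `s` have modes `-B ≤ r < B`. -/
def BoundedBy (B : ℕ) (s : State N) : Prop :=
  ∀ i, (∀ m : ℕ, B ≤ m → (m : ℤ) ∉ (s i).carrier) ∧
    ∀ n : ℕ, B ≤ n → (-(n : ℤ) - 1) ∈ (s i).carrier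

theorem BoundedBy.mono {B C : ℕ} {s : State N} (h : BoundedBy B s) (hBC : B ≤ C) :
    BoundedBy C s := fun i =>
  ⟨fun m hm => (h i).1 m (hBC.trans hm), fun n hn => (h i).2 n (hBC.trans hn)⟩

theorem exists_boundedBy (s : State N) : ∃ B, BoundedBy B s := by
  have hp : (⋃ i, {m : ℕ | (m : ℤ) ∈ (s i).carrier}).Finite := by
    refine Set.finite_iUnion fun i => ?_
    refine ((s i).finite_particles.preimage (f := fun m : ℕ => (m : ℤ))
      (fun a _ b _ hab => by simpa using hab)).subset fun m hm => ?_
    exact ⟨hm, by simp⟩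
  have hh : (⋃ j, {n : ℕ | (-(n : ℤ) - 1) ∉ (s j).carrier}).Finite := by
    refine Set.finite_iUnion fun j => ?_
    refine ((s j).finite_holes.preimage (f := fun n : ℕ => -(n : ℤ) - 1)
      (fun a _ b _ hab => by simp only at hab; omega)).subset fun n hn => ?_
    exact ⟨by simp only [Set.mem_Iio]; omega, hn⟩
  obtain ⟨B, hB⟩ := (hp.union hh).bddAbove
  refine ⟨B + 1, fun i => ⟨fun m hm hmem => ?_, fun n hn => ?_⟩⟩
  · have := hB (Or.inl (Set.mem_iUnion.2 ⟨i, hmem⟩))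
    omega
  · by_contra hmem
    have := hB (Or.inr (Set.mem_iUnion.2 ⟨i, hmem⟩))
    omega

theorem BoundedBy.addMode {B : ℕ} {s : State N} (h : BoundedBy B s) (i : Fin N) {r : ℤ}
    (hr : r < B) : BoundedBy B (addMode s i r) := by
  refine fun j => ⟨fun m hm hmem => ?_, fun n hn => mem_addMode.2 (Or.inr ((h j).2 n hn))⟩
  rcases mem_addMode.1 hmem with ⟨-, h1⟩ | h1
  · omega
  · exact (h j).1 m hm h1

theorem BoundedBy.removeMode {B : ℕ} {s : State N} (h : BoundedBy B s) (i : Fin N) {r : ℤ}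
    (hr : -(B : ℤ) ≤ r) : BoundedBy B (removeMode s i r) := by
  refine fun j => ⟨fun m hm hmem => (h j).1 m hm (mem_removeMode.1 hmem).1, fun n hn => ?_⟩
  refine mem_removeMode.2 ⟨(h j).2 n hn, ?_⟩
  rintro ⟨-, h1⟩
  omega

theorem particles_addMode_le (s : State N) (i : Fin N) (r : ℤ) :
    particles (addMode s i r) ≤ particles s + 1 := by
  unfold particles
  rw [← Finset.add_sum_erase _ _ (Finset.mem_univ i),
    ← Finset.add_sum_erase (a := i) Finset.univ (fun i => ((s i).carrier \ Set.Iio 0).ncard)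
      (Finset.mem_univ i)]
  have h1 : ∑ k ∈ Finset.univ.erase i, ((addMode s i r k).carrier \ Set.Iio 0).ncard =
      ∑ k ∈ Finset.univ.erase i, ((s k).carrier \ Set.Iio 0).ncard :=
    Finset.sum_congr rfl fun k hk => by
      rw [addMode, Function.update_of_ne (Finset.ne_of_mem_erase hk)]
  have h2 : ((addMode s i r i).carrier \ Set.Iio 0).ncard ≤
      ((s i).carrier \ Set.Iio 0).ncard + 1 := by
    refine le_trans (Set.ncard_le_ncard (t := Insert.insert r ((s i).carrier \ Set.Iio 0))
      ?_ ((s i).finite_particles.insert r)) (Set.ncard_insert_le _ _)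
    rintro x ⟨hx, hx'⟩
    rcases mem_addMode.1 hx with ⟨-, h⟩ | h
    · exact Or.inl h
    · exact Or.inr ⟨h, hx'⟩
  omega

theorem particles_mono {s t : State N} (h : ∀ i (m : ℕ), (m : ℤ) ∈ (s i).carrier →
    (m : ℤ) ∈ (t i).carrier) : particles s ≤ particles t := by
  refine Finset.sum_le_sum fun i _ => Set.ncard_le_ncard ?_ (t i).finite_particles
  rintro x ⟨hx, hx'⟩
  refine ⟨?_, hx'⟩
  lift x to ℕ using not_lt.1 hx'
  exact h i x hx

theorem particles_removeMode_le (s : State N) (i : Fin N) (r : ℤ) :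
    particles (removeMode s i r) ≤ particles s :=
  particles_mono fun _ _ h => (mem_removeMode.1 h).1

theorem particles_removeMode {s : State N} {i : Fin N} {m : ℕ} (h : (m : ℤ) ∈ (s i).carrier) :
    particles (removeMode s i m) < particles s := by
  unfold particles
  refine Finset.sum_lt_sum (fun k _ => Set.ncard_le_ncard ?_ (s k).finite_particles)
    ⟨i, Finset.mem_univ i, Set.ncard_lt_ncard ?_ (s i).finite_particles⟩
  · rintro x ⟨hx, hx'⟩
    exact ⟨(mem_removeMode.1 hx).1, hx'⟩
  · refine ⟨?_, fun hs => ?_⟩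
    · rintro x ⟨hx, hx'⟩
      exact ⟨(mem_removeMode.1 hx).1, hx'⟩
    · have := (hs ⟨h, by simp⟩ : (m : ℤ) ∈ (removeMode s i m i).carrier \ Set.Iio 0).1
      simp [mem_removeMode] at this

theorem particles_addMode_neg (s : State N) (i : Fin N) (n : ℕ) :
    particles (addMode s i (-(n : ℤ) - 1)) ≤ particles s :=
  particles_mono fun j m h => (mem_addMode.1 h).elim (fun h' => by omega) id

@[simp] theorem particles_vacuum : particles (fun _ : Fin N => AdmissibleSet.vacuum) = 0 := by
  simp [particles, AdmissibleSet.vacuum]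

@[simp] theorem totalCharge_vacuum : totalCharge (fun _ : Fin N => AdmissibleSet.vacuum) = 0 := by
  simp [totalCharge]

end Bounded

/-! ### Truncation to finitely many modes, and commutators with the quadratic creator. -/

section Operators

variable {K : Type*} [CommRing K] {N : ℕ}

theorem vacuum_vacuum : vacuum K N (fun _ => AdmissibleSet.vacuum) = 1 := by
  simp [vacuum, basisVector]

theorem vacuum_of_ne {s : State N} (h : s ≠ fun _ => AdmissibleSet.vacuum) :
    vacuum K N s = 0 := by
  simp [vacuum, basisVector, h]

theorem psiStar_vacuum (i : Fin N) (m : ℕ) : psiStar i (m : ℤ) (vacuum K N) = 0 := by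
  funext s
  by_cases h : (m : ℤ) ∈ (s i).carrier
  · rw [psiStar_of_mem h]; rfl
  · rw [psiStar_of_notMem h, vacuum_of_ne, mul_zero]
    · rfl
    · intro h1
      have h2 : (m : ℤ) ∈ (addMode s i m i).carrier := mem_addMode.2 (Or.inl ⟨rfl, rfl⟩)
      rw [h1] at h2
      simp only [AdmissibleSet.mem_vacuum] at h2
      omega

theorem psi_vacuum (j : Fin N) (n : ℕ) : psi j (-(n : ℤ) - 1) (vacuum K N) = 0 := by
  funext s
  by_cases h : (-(n : ℤ) - 1) ∈ (s j).carrier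
  · rw [psi_of_mem h, vacuum_of_ne, mul_zero]
    · rfl
    · intro h1
      have h2 : (-(n : ℤ) - 1) ∉ (removeMode s j (-(n : ℤ) - 1) j).carrier := by
        simp [mem_removeMode]
      rw [h1] at h2
      simp only [AdmissibleSet.mem_vacuum] at h2
      omega
  · rw [psi_of_notMem h]; rfl

/-- `v` and `w` agree on the states with modes in `[-B, B)` and fewer than `L` particles. -/
def AgreeBelow (B L : ℕ) (v w : FockVector K N) : Prop :=
  ∀ t, BoundedBy B t → particles t < L → v t = w t

theorem AgreeBelow.psi_apply {B L : ℕ} {v w : FockVector K N} (h : AgreeBelow B L v w)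
    {s : State N} (hs : BoundedBy B s) (hL : particles s < L) (i : Fin N) {r : ℤ}
    (hr : -(B : ℤ) ≤ r) : psi i r v s = psi i r w s := by
  by_cases h1 : r ∈ (s i).carrier
  · rw [psi_of_mem h1, psi_of_mem h1, h _ (hs.removeMode i hr)
      ((particles_removeMode_le _ _ _).trans_lt hL)]
  · rw [psi_of_notMem h1, psi_of_notMem h1]

/-- The value at `s` is read off at `s` with one mode added, which may be a particle. This costs one
unit in the particle bound, unlike for `psi`. -/
theorem AgreeBelow.psiStar_apply {B L : ℕ} {v w : FockVector K N} (h : AgreeBelow B L v w)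
    {s : State N} (hs : BoundedBy B s) (hL : particles s + 1 < L) (i : Fin N) {r : ℤ}
    (hr : r < B) : psiStar i r v s = psiStar i r w s := by
  by_cases h1 : r ∈ (s i).carrier
  · rw [psiStar_of_mem h1, psiStar_of_mem h1]
  · rw [psiStar_of_notMem h1, psiStar_of_notMem h1, h _ (hs.addMode i hr)
      ((particles_addMode_le _ _ _).trans_lt hL)]

/-- The modes `(i, m)` with `m < B`. -/
def modes (N B : ℕ) : Finset (Fin N × ℕ) := Finset.univ ×ˢ Finset.range B

theorem mem_modes {B : ℕ} {p : Fin N × ℕ} : p ∈ modes N B ↔ p.2 < B := by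
  simp [modes]

/-- The part of `quadraticCreator A` with modes below `B`, a finite sum of operators. -/
def truncatedCreator (A : Fin N → Fin N → ℕ → ℕ → K) (B : ℕ) :
    Module.End K (FockVector K N) :=
  ∑ p ∈ modes N B, ∑ h ∈ modes N B,
    A p.1 h.1 p.2 h.2 • (psi p.1 (p.2 : ℤ) * psiStar h.1 (-(h.2 : ℤ) - 1))

/-- A term contributes at `s` only if `s` contains its particle and its hole. Truncation turns the
formal infinite sum into a genuine endomorphism, so that commutators can be computed in a ring. -/
theorem quadraticCreator_eq_truncated (A : Fin N → Fin N → ℕ → ℕ → K) {B : ℕ} {s : State N}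
    (hs : BoundedBy B s) (v : FockVector K N) :
    quadraticCreator A v s = truncatedCreator A B v s := by
  unfold quadraticCreator truncatedCreator
  rw [finsum_eq_sum_of_support_subset (s := Finset.univ ×ˢ (Finset.range B ×ˢ Finset.range B))]
  · simp only [modes, Finset.sum_product, LinearMap.sum_apply, Finset.sum_apply,
      LinearMap.smul_apply, Module.End.mul_apply, Pi.smul_apply, smul_eq_mul,
      ← Finset.univ_product_univ]
    exact Finset.sum_congr rfl fun i _ => Finset.sum_comm
  · intro q hq
    obtain ⟨h1, h2, -⟩ := psi_psiStar_ne_zero (right_ne_zero_of_mul hq)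
    simp only [Finset.coe_product, Set.mem_prod, Finset.coe_univ, Set.mem_univ, true_and,
      Finset.coe_range, Set.mem_Iio]
    constructor
    · by_contra hc
      exact (hs _).1 _ (not_lt.1 hc) h1
    · by_contra hc
      exact h2 ((hs _).2 _ (not_lt.1 hc))

theorem iterate_quadraticCreator_eq_truncated (A : Fin N → Fin N → ℕ → ℕ → K) (B k : ℕ) :
    ∀ s, BoundedBy B s →
      ((quadraticCreator A)^[k] (vacuum K N)) s = (truncatedCreator A B ^ k) (vacuum K N) s := by
  induction k with
  | zero => intro s _; rfl
  | succ k ih =>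
    intro s hs
    rw [Function.iterate_succ_apply', pow_succ', Module.End.mul_apply,
      quadraticCreator_eq_truncated A hs]
    generalize hw : (truncatedCreator A B ^ k) (vacuum K N) = w at ih ⊢
    simp only [truncatedCreator, LinearMap.sum_apply, Finset.sum_apply,
      LinearMap.smul_apply, Module.End.mul_apply, Pi.smul_apply, smul_eq_mul]
    refine Finset.sum_congr rfl fun p hp => Finset.sum_congr rfl fun h hh => ?_
    congr 1
    by_cases h1 : (p.2 : ℤ) ∈ (s p.1).carrier
    · rw [psi_of_mem h1, psi_of_mem h1]
      congr 1
      -- Undoing a pair with modes below `B` stays in the window, so the induction hypothesis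
      -- applies.
      have hs' : BoundedBy B (removeMode s p.1 p.2) := hs.removeMode _ (by omega)
      by_cases h2 : (-(h.2 : ℤ) - 1) ∈ (removeMode s p.1 p.2 h.1).carrier
      · rw [psiStar_of_mem h2, psiStar_of_mem h2]
      · rw [psiStar_of_notMem h2, psiStar_of_notMem h2, ih _ (hs'.addMode _ (by omega))]
    · rw [psi_of_notMem h1, psi_of_notMem h1]

/-- The operator `∑_{j,n} A^{ij}_{mn} ψ^{j*}_{-(n+1/2)}` applied to `v`. -/
def contractHoles (A : Fin N → Fin N → ℕ → ℕ → K) (i : Fin N) (m : ℕ) (v : FockVector K N) :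
    FockVector K N :=
  fun s => ∑ᶠ h : Fin N × ℕ, A i h.1 m h.2 * psiStar h.1 (-(h.2 : ℤ) - 1) v s

/-- The operator `∑_{i,m} A^{ij}_{mn} ψ^i_{m+1/2}` applied to `v`. -/
def contractParticles (A : Fin N → Fin N → ℕ → ℕ → K) (j : Fin N) (n : ℕ)
    (v : FockVector K N) : FockVector K N :=
  fun s => ∑ᶠ p : Fin N × ℕ, A p.1 j p.2 n * psi p.1 (p.2 : ℤ) v s

theorem support_psiStar_subset {B : ℕ} {s : State N} (hs : BoundedBy B s)
    (v : FockVector K N) (c : Fin N × ℕ → K) :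
    (Function.support fun h : Fin N × ℕ => c h * psiStar h.1 (-(h.2 : ℤ) - 1) v s) ⊆
      modes N B := by
  intro h hh
  rw [Finset.mem_coe, mem_modes]
  by_contra hc
  exact hh (by simp only [psiStar_of_mem ((hs h.1).2 _ (not_lt.1 hc)), mul_zero])

theorem support_psi_subset {B : ℕ} {s : State N} (hs : BoundedBy B s)
    (v : FockVector K N) (c : Fin N × ℕ → K) :
    (Function.support fun p : Fin N × ℕ => c p * psi p.1 (p.2 : ℤ) v s) ⊆ modes N B := by
  intro p hp
  rw [Finset.mem_coe, mem_modes]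
  by_contra hc
  exact hp (by simp only [psi_of_notMem ((hs p.1).1 _ (not_lt.1 hc)), mul_zero])

theorem contractHoles_eq_sum (A : Fin N → Fin N → ℕ → ℕ → K) (i : Fin N) (m : ℕ)
    (v : FockVector K N) {B : ℕ} {s : State N} (hs : BoundedBy B s) :
    contractHoles A i m v s =
      ∑ h ∈ modes N B, A i h.1 m h.2 * psiStar h.1 (-(h.2 : ℤ) - 1) v s :=
  finsum_eq_sum_of_support_subset _ (support_psiStar_subset hs v fun h => A i h.1 m h.2)

theorem contractParticles_eq_sum (A : Fin N → Fin N → ℕ → ℕ → K) (j : Fin N) (n : ℕ)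
    (v : FockVector K N) {B : ℕ} {s : State N} (hs : BoundedBy B s) :
    contractParticles A j n v s =
      ∑ p ∈ modes N B, A p.1 j p.2 n * psi p.1 (p.2 : ℤ) v s :=
  finsum_eq_sum_of_support_subset _ (support_psi_subset hs v fun p => A p.1 j p.2 n)

/-- The truncation of `contractHoles` to modes below `B`. -/
def truncatedHoles (A : Fin N → Fin N → ℕ → ℕ → K) (B : ℕ) (i : Fin N) (m : ℕ) :
    Module.End K (FockVector K N) :=
  ∑ h ∈ modes N B, A i h.1 m h.2 • psiStar h.1 (-(h.2 : ℤ) - 1)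

/-- The truncation of `contractParticles` to modes below `B`. -/
def truncatedParticles (A : Fin N → Fin N → ℕ → ℕ → K) (B : ℕ) (j : Fin N) (n : ℕ) :
    Module.End K (FockVector K N) :=
  ∑ p ∈ modes N B, A p.1 j p.2 n • psi p.1 (p.2 : ℤ)

/-- Passing both factors of the pair costs two signs, which cancel. The only correction is the
contraction of `ψ^{i*}_{m+1/2}` with an equal creator. -/
theorem psiStar_mul_pair (i i' j : Fin N) (m m' n : ℕ) :
    (psiStar i (m : ℤ) * (psi i' (m' : ℤ) * psiStar j (-(n : ℤ) - 1)) :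
      Module.End K (FockVector K N)) =
    psi i' (m' : ℤ) * psiStar j (-(n : ℤ) - 1) * psiStar i (m : ℤ) +
      if (i', m') = (i, m) then psiStar j (-(n : ℤ) - 1) else 0 := by
  refine LinearMap.ext fun v => ?_
  simp only [Module.End.mul_apply, LinearMap.add_apply]
  split_ifs with h
  · simp only [Prod.mk.injEq] at h
    obtain ⟨rfl, rfl⟩ := h
    rw [psiStar_psi_self, psiStar_psiStar, map_neg]
    abel
  · rw [psiStar_psi_of_ne (by simpa using h), psiStar_psiStar i, map_neg]
    simp

theorem psi_mul_pair (i j j' : Fin N) (m n n' : ℕ) :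
    (psi j (-(n : ℤ) - 1) * (psi i (m : ℤ) * psiStar j' (-(n' : ℤ) - 1)) :
      Module.End K (FockVector K N)) =
    psi i (m : ℤ) * psiStar j' (-(n' : ℤ) - 1) * psi j (-(n : ℤ) - 1) +
      if (j', n') = (j, n) then -psi i (m : ℤ) else 0 := by
  refine LinearMap.ext fun v => ?_
  simp only [Module.End.mul_apply, LinearMap.add_apply]
  split_ifs with h
  · simp only [Prod.mk.injEq] at h
    obtain ⟨rfl, rfl⟩ := h
    rw [psiStar_psi_self, psi_psi, map_sub, LinearMap.neg_apply]
    abel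
  · have h' : ¬ (j = j' ∧ (-(n : ℤ) - 1) = -(n' : ℤ) - 1) := by
      rintro ⟨rfl, h1⟩
      exact h (by simp only [Prod.mk.injEq, true_and]; omega)
    rw [psiStar_psi_of_ne h', psi_psi j, map_neg]
    simp

theorem psiStar_mul_truncatedCreator (A : Fin N → Fin N → ℕ → ℕ → K) {B : ℕ} (i : Fin N)
    {m : ℕ} (hm : m < B) :
    psiStar i (m : ℤ) * truncatedCreator A B =
      truncatedCreator A B * psiStar i (m : ℤ) + truncatedHoles A B i m := by
  simp only [truncatedCreator, truncatedHoles, Finset.mul_sum, Finset.sum_mul, mul_smul_comm,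
    smul_mul_assoc, psiStar_mul_pair, smul_add, Finset.sum_add_distrib, smul_ite, smul_zero]
  congr 1
  rw [Finset.sum_comm]
  refine Finset.sum_congr rfl fun h _ => ?_
  simp only [Prod.mk.eta]
  rw [Finset.sum_ite_eq' (modes N B) (i, m), if_pos (mem_modes.2 hm)]

theorem psi_mul_truncatedCreator (A : Fin N → Fin N → ℕ → ℕ → K) {B : ℕ} (j : Fin N)
    {n : ℕ} (hn : n < B) :
    psi j (-(n : ℤ) - 1) * truncatedCreator A B =
      truncatedCreator A B * psi j (-(n : ℤ) - 1) + -truncatedParticles A B j n := by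
  simp only [truncatedCreator, truncatedParticles, Finset.mul_sum, Finset.sum_mul, mul_smul_comm,
    smul_mul_assoc, psi_mul_pair, smul_add, Finset.sum_add_distrib, smul_ite, smul_zero]
  congr 1
  rw [← Finset.sum_neg_distrib]
  refine Finset.sum_congr rfl fun h _ => ?_
  simp only [Prod.mk.eta]
  rw [Finset.sum_ite_eq' (modes N B) (j, n), if_pos (mem_modes.2 hn), smul_neg]

/-- A `ψ^*` with negative index anticommutes with both factors of each pair, as its mode never
equals that of a particle. So the commutator is itself central for the creator. -/
theorem truncatedHoles_commute (A : Fin N → Fin N → ℕ → ℕ → K) (B : ℕ) (i : Fin N) (m : ℕ) :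
    Commute (truncatedCreator A B) (truncatedHoles A B i m) := by
  refine Commute.sum_left _ _ _ fun p _ => Commute.sum_left _ _ _ fun h _ =>
    Commute.sum_right _ _ _ fun h' _ => Commute.smul_left (Commute.smul_right ?_ _) _
  refine LinearMap.ext fun v => ?_
  simp only [Module.End.mul_apply]
  rw [psiStar_psi_of_ne (i := h'.1) (j := p.1) (by omega), psiStar_psiStar h'.1, map_neg, neg_neg]

theorem truncatedParticles_commute (A : Fin N → Fin N → ℕ → ℕ → K) (B : ℕ) (j : Fin N)
    (n : ℕ) : Commute (truncatedCreator A B) (-truncatedParticles A B j n) := by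
  suffices h : Commute (truncatedCreator A B) (truncatedParticles A B j n) from h.neg_right
  refine Commute.sum_left _ _ _ fun p _ => Commute.sum_left _ _ _ fun h _ =>
    Commute.sum_right _ _ _ fun p' _ => Commute.smul_left (Commute.smul_right ?_ _) _
  refine LinearMap.ext fun v => ?_
  simp only [Module.End.mul_apply]
  rw [psiStar_psi_of_ne (i := h.1) (j := p'.1) (by omega), map_neg, psi_psi p'.1]

/-- The Leibniz rule: commutation with `a` acts on powers of `x` as a derivation, with `y` as the
derivative of `x`. -/
theorem mul_pow_of_commutator {E : Type*} [Ring E] {a x y : E} (h : a * x = x * a + y)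
    (hc : Commute x y) (k : ℕ) : a * x ^ (k + 1) = x ^ (k + 1) * a + (k + 1) • (y * x ^ k) := by
  induction k with
  | zero => simpa using h
  | succ k ih =>
    rw [pow_succ, ← mul_assoc, ih, add_mul, mul_assoc, h, smul_mul_assoc, mul_assoc y,
      ← pow_succ, mul_add, ← mul_assoc, ← pow_succ, (hc.pow_left (k + 1)).eq, add_smul (k + 1) 1,
      one_smul]
    abel

end Operators

/-! ### The contraction identities of a Bogoliubov transform. -/

section Contraction

variable {K : Type*} [CommRing K] {N : ℕ}

theorem totalCharge_iterate_quadraticCreator (A : Fin N → Fin N → ℕ → ℕ → K) (k : ℕ)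
    (s : State N) (h : ((quadraticCreator A)^[k] (vacuum K N)) s ≠ 0) : totalCharge s = 0 := by
  induction k generalizing s with
  | zero =>
    have : s = fun _ => AdmissibleSet.vacuum := by
      by_contra hs
      exact h (vacuum_of_ne hs)
    rw [this, totalCharge_vacuum]
  | succ k ih =>
    rw [Function.iterate_succ_apply'] at h
    obtain ⟨q, hq⟩ : ∃ q : (Fin N × Fin N) × (ℕ × ℕ), A q.1.1 q.1.2 q.2.1 q.2.2 *
        psi q.1.1 (q.2.1 : ℤ) (psiStar q.1.2 (-(q.2.2 : ℤ) - 1)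
          ((quadraticCreator A)^[k] (vacuum K N))) s ≠ 0 := by
      by_contra hc
      push Not at hc
      exact h (by simp only [quadraticCreator, hc, finsum_zero])
    obtain ⟨h1, h2, h3⟩ := psi_psiStar_ne_zero (right_ne_zero_of_mul hq)
    have h4 := ih _ h3
    change totalCharge (addMode (removeMode s q.1.1 q.2.1) q.1.2 (-(q.2.2 : ℤ) - 1)) = 0 at h4
    rw [totalCharge_addMode fun h => h2 (mem_removeMode.1 h).1, totalCharge_removeMode h1] at h4
    omega

variable [Algebra ℚ K]

theorem totalCharge_eq_zero_of_bogoliubov_ne_zero (A : Fin N → Fin N → ℕ → ℕ → K) {s : State N}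
    (h : bogoliubov A s ≠ 0) : totalCharge s = 0 := by
  by_contra hs
  refine h (finsum_eq_zero_of_forall_eq_zero fun k => ?_)
  by_contra hk
  exact hs (totalCharge_iterate_quadraticCreator A k s (right_ne_zero_of_smul hk))

/-- The `k`-th term of the series lives on states with exactly `k` particles, so only `k = 0`
reaches the vacuum. -/
theorem bogoliubov_vacuum (A : Fin N → Fin N → ℕ → ℕ → K) :
    bogoliubov A (fun _ => AdmissibleSet.vacuum) = 1 := by
  unfold bogoliubov
  rw [finsum_eq_single _ 0]
  · simp [vacuum_vacuum]
  · intro k hk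
    by_contra hc
    have := iterate_quadraticCreator_vacuum A k _ (right_ne_zero_of_smul hc)
    rw [particles_vacuum] at this
    exact hk this.symm

/-- The partial sum of the exponential series with `L` terms and with modes below `B`. -/
def truncatedExp (A : Fin N → Fin N → ℕ → ℕ → K) (B L : ℕ) : FockVector K N :=
  ∑ k ∈ Finset.range L,
    algebraMap ℚ K (k.factorial : ℚ)⁻¹ • (truncatedCreator A B ^ k) (vacuum K N)

theorem agreeBelow_truncatedExp (A : Fin N → Fin N → ℕ → ℕ → K) (B L : ℕ) :
    AgreeBelow B L (bogoliubov A) (truncatedExp A B L) := by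
  intro s hs hL
  unfold bogoliubov truncatedExp
  rw [finsum_eq_sum_of_support_subset (s := Finset.range L), Finset.sum_apply]
  · refine Finset.sum_congr rfl fun k _ => ?_
    rw [iterate_quadraticCreator_eq_truncated A B k s hs, Pi.smul_apply, algebraMap_smul]
  · intro k hk
    have := iterate_quadraticCreator_vacuum A k s (right_ne_zero_of_smul hk)
    rw [Finset.coe_range, Set.mem_Iio]
    omega

/-- This is `a exp(x) |0⟩ = y exp(x) |0⟩` for `a |0⟩ = 0`: the factor `k + 1` of the Leibniz rule
cancels against the factorial. The index shift makes the right-hand series one term shorter. -/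
theorem apply_truncatedExp {A : Fin N → Fin N → ℕ → ℕ → K} {B : ℕ}
    {a y : Module.End K (FockVector K N)}
    (h : a * truncatedCreator A B = truncatedCreator A B * a + y)
    (hc : Commute (truncatedCreator A B) y) (h0 : a (vacuum K N) = 0) (L : ℕ) :
    a (truncatedExp A B (L + 1)) = y (truncatedExp A B L) := by
  unfold truncatedExp
  rw [Finset.sum_range_succ', map_add, map_sum, map_smul, pow_zero, Module.End.one_apply, h0,
    smul_zero, add_zero, map_sum]
  refine Finset.sum_congr rfl fun k _ => ?_
  have h1 := LinearMap.congr_fun (mul_pow_of_commutator h hc k) (vacuum K N)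
  simp only [Module.End.mul_apply, LinearMap.add_apply, LinearMap.smul_apply, h0, map_zero,
    zero_add] at h1
  rw [map_smul, map_smul, h1, ← Nat.cast_smul_eq_nsmul K, smul_smul]
  congr 1
  rw [← map_natCast (algebraMap ℚ K), ← map_mul]
  congr 1
  rw [Nat.factorial_succ]
  push_cast
  field_simp

/-- `ψ^{i*}_{m+1/2} V = ∑_{j,n} A^{ij}_{mn} ψ^{j*}_{-(n+1/2)} V` for a Bogoliubov transform. -/
theorem psiStar_bogoliubov (A : Fin N → Fin N → ℕ → ℕ → K) (i : Fin N) (m : ℕ) :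
    psiStar i (m : ℤ) (bogoliubov A) = contractHoles A i m (bogoliubov A) := by
  funext u
  obtain ⟨B₀, hB₀⟩ := exists_boundedBy u
  obtain ⟨B, hB, hm⟩ : ∃ B, BoundedBy B u ∧ m < B :=
    ⟨B₀ + m + 1, hB₀.mono (by omega), by omega⟩
  -- The operators `ψ^*` can raise the number of particles to `particles u + 1`, so `particles u +
  -- 2` terms suffice on the right, and the left needs one more for the shift.
  rw [(agreeBelow_truncatedExp A B (particles u + 2 + 1)).psiStar_apply hB (by omega) i
      (by omega),
    apply_truncatedExp (psiStar_mul_truncatedCreator A i hm) (truncatedHoles_commute A B i m)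
      (psiStar_vacuum i m), contractHoles_eq_sum A i m _ hB]
  simp only [truncatedHoles, LinearMap.sum_apply, Finset.sum_apply, LinearMap.smul_apply,
    Pi.smul_apply, smul_eq_mul]
  refine Finset.sum_congr rfl fun h _ => ?_
  rw [(agreeBelow_truncatedExp A B (particles u + 2)).psiStar_apply hB (by omega) h.1 (by omega)]

/-- `ψ^j_{-(n+1/2)} V = -∑_{i,m} A^{ij}_{mn} ψ^i_{m+1/2} V` for a Bogoliubov transform. -/
theorem psi_bogoliubov (A : Fin N → Fin N → ℕ → ℕ → K) (j : Fin N) (n : ℕ) :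
    psi j (-(n : ℤ) - 1) (bogoliubov A) = -contractParticles A j n (bogoliubov A) := by
  funext u
  obtain ⟨B₀, hB₀⟩ := exists_boundedBy u
  obtain ⟨B, hB, hn⟩ : ∃ B, BoundedBy B u ∧ n < B :=
    ⟨B₀ + n + 1, hB₀.mono (by omega), by omega⟩
  rw [(agreeBelow_truncatedExp A B (particles u + 2 + 1)).psi_apply hB (by omega) j
      (by omega),
    apply_truncatedExp (psi_mul_truncatedCreator A j hn) (truncatedParticles_commute A B j n)
      (psi_vacuum j n), Pi.neg_apply, contractParticles_eq_sum A j n _ hB]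
  simp only [truncatedParticles, LinearMap.neg_apply, LinearMap.sum_apply, Finset.sum_apply,
    LinearMap.smul_apply, Pi.smul_apply, smul_eq_mul, Pi.neg_apply]
  congr 1
  refine Finset.sum_congr rfl fun p _ => ?_
  rw [(agreeBelow_truncatedExp A B (particles u + 2)).psi_apply hB (by omega) p.1 (by omega)]

end Contraction

/-! ### Contraction identities characterize Bogoliubov transforms. -/

section Uniqueness

variable {K : Type*} [CommRing K] {N : ℕ}

theorem eq_vacuum_of_particles_eq_zero {s : State N} (hp : particles s = 0)
    (hc : totalCharge s = 0) : s = fun _ => AdmissibleSet.vacuum := by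
  have h1 : ∀ i, (s i).carrier \ Set.Iio 0 = ∅ := fun i => by
    have := Finset.sum_eq_zero_iff.1 hp i (Finset.mem_univ i)
    rwa [Set.ncard_eq_zero (s i).finite_particles] at this
  have h2 : ∑ i, ((Set.Iio 0 \ (s i).carrier).ncard : ℤ) = 0 := by
    rw [totalCharge] at hc
    simp only [AdmissibleSet.charge, h1, Set.ncard_empty, Nat.cast_zero, zero_sub,
      Finset.sum_neg_distrib] at hc
    omega
  have h3 : ∀ i, Set.Iio 0 \ (s i).carrier = ∅ := fun i => by
    have := (Finset.sum_eq_zero_iff_of_nonneg fun _ _ => by positivity).1 h2 i (Finset.mem_univ i)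
    rwa [Nat.cast_eq_zero, Set.ncard_eq_zero (s i).finite_holes] at this
  refine State.ext_mem fun i r => ⟨fun h => ?_, fun h => ?_⟩
  · by_contra hr
    exact (h1 i ▸ ⟨h, hr⟩ : r ∈ (∅ : Set ℤ))
  · by_contra hr
    exact (h3 i ▸ ⟨h, hr⟩ : r ∈ (∅ : Set ℤ))

theorem exists_particle {s : State N} (hp : particles s ≠ 0) :
    ∃ i, ∃ m : ℕ, (m : ℤ) ∈ (s i).carrier := by
  by_contra! hc
  refine hp (Finset.sum_eq_zero fun i _ => ?_)
  rw [Set.ncard_eq_zero (s i).finite_particles]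
  refine Set.eq_empty_iff_forall_notMem.2 fun x hx => ?_
  obtain ⟨m, rfl⟩ := Int.eq_ofNat_of_zero_le (not_lt.1 hx.2)
  exact hc i m hx.1

/-- The expansion of a coefficient along one of its particles. -/
theorem expand_particle {A : Fin N → Fin N → ℕ → ℕ → K} {v : FockVector K N} {i : Fin N} {m : ℕ}
    (hv : psiStar i (m : ℤ) v = contractHoles A i m v) {s : State N}
    (hm : (m : ℤ) ∈ (s i).carrier) :
    v s = opSign K s i m * contractHoles A i m v (removeMode s i m) := by
  have h2 : (m : ℤ) ∉ (removeMode s i m i).carrier := by simp [mem_removeMode]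
  rw [← hv, psiStar_of_notMem h2, addMode_removeMode hm, opSign_removeMode hm, crossSign_self,
    one_mul, ← mul_assoc, opSign_mul_self, one_mul]

/-- A vector of charge zero that satisfies the contraction identities of the Bogoliubov transform
with coefficients `A` is determined by its vacuum coefficient. -/
theorem eq_of_contractHoles {A : Fin N → Fin N → ℕ → ℕ → K} {v w : FockVector K N}
    (hv : ∀ i (m : ℕ), psiStar i (m : ℤ) v = contractHoles A i m v)
    (hw : ∀ i (m : ℕ), psiStar i (m : ℤ) w = contractHoles A i m w)
    (hv0 : ∀ s, totalCharge s ≠ 0 → v s = 0) (hw0 : ∀ s, totalCharge s ≠ 0 → w s = 0)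
    (h : v (fun _ => AdmissibleSet.vacuum) = w fun _ => AdmissibleSet.vacuum) : v = w := by
  funext s
  -- Removing a particle lowers the count and filling a hole does not raise it, so the expansion
  -- along a particle is a recursion. It ends at states without particles, where charge zero leaves
  -- only the vacuum.
  induction hk : particles s using Nat.strong_induction_on generalizing s with
  | _ k ih =>
    by_cases hc : totalCharge s = 0
    swap
    · rw [hv0 s hc, hw0 s hc]
    by_cases hp : particles s = 0
    · rw [eq_vacuum_of_particles_eq_zero hp hc, h]
    obtain ⟨i, m, hm⟩ := exists_particle hp
    rw [expand_particle (hv i m) hm, expand_particle (hw i m) hm]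
    congr 1
    refine finsum_congr fun q => ?_
    congr 1
    by_cases hq : (-(q.2 : ℤ) - 1) ∈ (removeMode s i m q.1).carrier
    · rw [psiStar_of_mem hq, psiStar_of_mem hq]
    · rw [psiStar_of_notMem hq, psiStar_of_notMem hq]
      congr 1
      refine ih _ ?_ _ rfl
      rw [← hk]
      exact (particles_addMode_neg _ _ _).trans_lt (particles_removeMode hm)

theorem map_opSign {L : Type*} [CommRing L] (φ : K →+* L) (s : State N) (i : Fin N) (r : ℤ) :
    φ (opSign K s i r) = opSign L s i r := by
  simp [opSign]

theorem map_psiStar {L : Type*} [CommRing L] (φ : K →+* L) (v : FockVector K N) (i : Fin N)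
    (r : ℤ) (s : State N) : φ (psiStar i r v s) = psiStar i r (fun t => φ (v t)) s := by
  by_cases h : r ∈ (s i).carrier
  · rw [psiStar_of_mem h, psiStar_of_mem h, map_zero]
  · rw [psiStar_of_notMem h, psiStar_of_notMem h, map_mul, map_opSign]

variable [Algebra ℚ K]

/-- The identities are linear, so the multiple of the transform also satisfies them and uniqueness
applies. No invertibility of the vacuum coefficient is needed, which is what the unnormalized gluing
requires. -/
theorem eq_smul_bogoliubov {A : Fin N → Fin N → ℕ → ℕ → K} {v : FockVector K N}
    (hv : ∀ i (m : ℕ), psiStar i (m : ℤ) v = contractHoles A i m v)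
    (hv0 : ∀ s, totalCharge s ≠ 0 → v s = 0) :
    v = v (fun _ => AdmissibleSet.vacuum) • bogoliubov A := by
  refine eq_of_contractHoles hv (fun i m => ?_) hv0 (fun s hs => ?_) ?_
  · rw [map_smul, psiStar_bogoliubov]
    funext s
    obtain ⟨B, hB⟩ := exists_boundedBy s
    rw [Pi.smul_apply, contractHoles_eq_sum A i m _ hB, contractHoles_eq_sum A i m _ hB,
      Finset.smul_sum]
    refine Finset.sum_congr rfl fun h _ => ?_
    rw [map_smul, Pi.smul_apply, smul_eq_mul, smul_eq_mul, mul_left_comm]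
  · have : bogoliubov A s = 0 := by
      by_contra hc
      exact hs (totalCharge_eq_zero_of_bogoliubov_ne_zero A hc)
    rw [Pi.smul_apply, this, smul_zero]
  · rw [Pi.smul_apply, bogoliubov_vacuum, smul_eq_mul, mul_one]

theorem eq_bogoliubov {A : Fin N → Fin N → ℕ → ℕ → K} {v : FockVector K N}
    (hv : ∀ i (m : ℕ), psiStar i (m : ℤ) v = contractHoles A i m v)
    (hv0 : ∀ s, totalCharge s ≠ 0 → v s = 0) (h : v (fun _ => AdmissibleSet.vacuum) = 1) :
    v = bogoliubov A := by
  rw [eq_smul_bogoliubov hv hv0, h, one_smul]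

theorem bogoliubov_eq_zero_of_totalCharge (A : Fin N → Fin N → ℕ → ℕ → K) {s : State N}
    (hs : totalCharge s ≠ 0) : bogoliubov A s = 0 := by
  by_contra hc
  exact hs (totalCharge_eq_zero_of_bogoliubov_ne_zero A hc)

/-- Base change preserves the contraction identities, the charge and the vacuum coefficient. It is
used for reduction modulo `Q ^ d` and for the constant term in `Q`. -/
theorem map_bogoliubov {L : Type*} [CommRing L] [Algebra ℚ L] (φ : K →+* L)
    (A : Fin N → Fin N → ℕ → ℕ → K) :
    (fun s => φ (bogoliubov A s)) = bogoliubov fun i j m n => φ (A i j m n) := by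
  refine eq_bogoliubov (fun i m => ?_) (fun s hs => ?_) ?_
  · funext s
    obtain ⟨B, hB⟩ := exists_boundedBy s
    rw [← map_psiStar, psiStar_bogoliubov, contractHoles_eq_sum A i m _ hB,
      contractHoles_eq_sum _ i m _ hB, map_sum]
    simp only [map_mul, map_psiStar]
  · rw [bogoliubov_eq_zero_of_totalCharge A hs, map_zero]
  · rw [bogoliubov_vacuum, map_one]

end Uniqueness

/-! ### States restricted along a map of factors, and multiplicativity of signs. -/

section Reindex

variable {K : Type*} [CommRing K] {M N : ℕ}

theorem addMode_comp {e : Fin M → Fin N} (he : Function.Injective e) (s : State N) (i : Fin M)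
    (r : ℤ) : addMode s (e i) r ∘ e = addMode (s ∘ e) i r :=
  State.ext_mem fun j q => by
    rw [Function.comp_apply, mem_addMode, mem_addMode, he.eq_iff, Function.comp_apply]

theorem addMode_comp_of_notMem {e : Fin M → Fin N} (s : State N) {k : Fin N} (hk : ∀ j, e j ≠ k)
    (r : ℤ) : addMode s k r ∘ e = s ∘ e :=
  State.ext_mem fun j q => by
    rw [Function.comp_apply, mem_addMode, Function.comp_apply]
    simp [hk j]

theorem BoundedBy.comp {B : ℕ} {s : State N} (h : BoundedBy B s) (e : Fin M → Fin N) :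
    BoundedBy B (s ∘ e) := fun i => h (e i)

theorem intSign_add (a b : ℤ) : intSign K (a + b) = intSign K a * intSign K b := by
  simp only [intSign_eq, Int.even_add]
  by_cases ha : Even a <;> by_cases hb : Even b <;> simp [ha, hb]

theorem intSign_sum {ι : Type*} (t : Finset ι) (c : ι → ℤ) :
    intSign K (∑ i ∈ t, c i) = ∏ i ∈ t, intSign K (c i) := by
  classical
  induction t using Finset.induction_on with
  | empty => simp
  | insert a t ha ih => rw [Finset.sum_insert ha, Finset.prod_insert ha, intSign_add, ih]

theorem opSign_eq_prod (s : State N) (i : Fin N) (r : ℤ) :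
    opSign K s i r =
      (∏ k, if k < i then intSign K (s k).charge else 1) * (-1) ^ (s i).above r := by
  rw [opSign_eq, Finset.prod_ite, Finset.prod_const_one, mul_one]
  congr 2
  ext k
  simp

end Reindex

/-! ### The tensor product of two Bogoliubov transforms. -/

section Tensor

variable {K : Type*} [CommRing K] {M N : ℕ}

@[simp] theorem leftSlot_castAdd (i : Fin M) :
    leftSlot M N (Fin.castAdd 1 i) = Fin.castAdd 2 (Fin.castAdd N i) := by simp [leftSlot]

@[simp] theorem leftSlot_natAdd (i : Fin 1) :
    leftSlot M N (Fin.natAdd M i) = Fin.natAdd (M + N) (0 : Fin 2) := by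
  simp only [leftSlot, Fin.append_right]

@[simp] theorem rightSlot_castAdd (j : Fin N) :
    rightSlot M N (Fin.castAdd 1 j) = Fin.castAdd 2 (Fin.natAdd M j) := by simp [rightSlot]

@[simp] theorem rightSlot_natAdd (j : Fin 1) :
    rightSlot M N (Fin.natAdd N j) = Fin.natAdd (M + N) (1 : Fin 2) := by
  simp only [rightSlot, Fin.append_right]

theorem splitSlot_leftSlot (i : Fin (M + 1)) : splitSlot M N (leftSlot M N i) = Sum.inl i := by
  refine Fin.addCases (fun i => ?_) (fun i => ?_) i
  · rw [leftSlot_castAdd, splitSlot, Fin.append_left, Fin.append_left]; rfl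
  · rw [leftSlot_natAdd, splitSlot, Fin.append_right, Subsingleton.elim i 0]; rfl

theorem splitSlot_rightSlot (j : Fin (N + 1)) : splitSlot M N (rightSlot M N j) = Sum.inr j := by
  refine Fin.addCases (fun i => ?_) (fun i => ?_) j
  · rw [rightSlot_castAdd, splitSlot, Fin.append_left, Fin.append_right]; rfl
  · rw [rightSlot_natAdd, splitSlot, Fin.append_right, Subsingleton.elim i 0]; rfl

theorem elim_splitSlot (p : Fin (M + N + 2)) :
    Sum.elim (leftSlot M N) (rightSlot M N) (splitSlot M N p) = p := by
  refine Fin.addCases (fun p => Fin.addCases (fun i => ?_) (fun i => ?_) p) (fun i => ?_) p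
  rotate_left
  · rw [splitSlot, Fin.append_left, Fin.append_left]; exact leftSlot_castAdd i
  · rw [splitSlot, Fin.append_left, Fin.append_right]; exact rightSlot_castAdd i
  · rw [splitSlot, Fin.append_right]
    fin_cases i
    · exact leftSlot_natAdd 0
    · exact rightSlot_natAdd 0

/-- The components `1, …, M + N, a, b` split as `1, …, M, a` and `M + 1, …, M + N, b`. -/
def slotEquiv (M N : ℕ) : Fin (M + 1) ⊕ Fin (N + 1) ≃ Fin (M + N + 2) where
  toFun := Sum.elim (leftSlot M N) (rightSlot M N)
  invFun := splitSlot M N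
  left_inv := by
    rintro (i | j)
    · exact splitSlot_leftSlot i
    · exact splitSlot_rightSlot j
  right_inv := elim_splitSlot

theorem sum_slots {α : Type*} [AddCommMonoid α] (f : Fin (M + N + 2) → α) :
    ∑ p, f p = ∑ i, f (leftSlot M N i) + ∑ j, f (rightSlot M N j) := by
  rw [← (slotEquiv M N).sum_comp, Fintype.sum_sum_type]
  rfl

theorem leftSlot_injective : Function.Injective (leftSlot M N) := fun i j h =>
  Sum.inl_injective (by rw [← splitSlot_leftSlot (N := N), h, splitSlot_leftSlot])

theorem rightSlot_injective : Function.Injective (rightSlot M N) := fun i j h =>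
  Sum.inr_injective (by rw [← splitSlot_rightSlot (M := M), h, splitSlot_rightSlot])

theorem leftSlot_ne_rightSlot (i : Fin (M + 1)) (j : Fin (N + 1)) :
    leftSlot M N i ≠ rightSlot M N j := fun h => by
  have := congrArg (splitSlot M N) h
  rw [splitSlot_leftSlot, splitSlot_rightSlot] at this
  cases this

/-- The components `M + 1, …, M + N`. -/
def middle (s : State (M + N + 2)) : State N :=
  s ∘ fun j : Fin N => Fin.castAdd 2 (Fin.natAdd M j)

/-- The Koszul sign in `tensor`. -/
def tensorSign (K : Type*) [CommRing K] (s : State (M + N + 2)) : K :=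
  if Even (s (Fin.natAdd (M + N) (0 : Fin 2))).charge then 1
  else intSign K (totalCharge (middle s))

theorem tensor_apply (V₁ : FockVector K (M + 1)) (V₂ : FockVector K (N + 1))
    (s : State (M + N + 2)) :
    tensor V₁ V₂ s = tensorSign K s * (V₁ (s ∘ leftSlot M N) * V₂ (s ∘ rightSlot M N)) := by
  unfold tensor tensorSign
  congr 1
  rw [pow_mul]
  split_ifs with h
  · rw [(Int.natAbs_even.2 h).neg_one_pow, one_pow]
  · rw [(Int.natAbs_odd.2 (Int.not_even_iff_odd.1 h)).neg_one_pow, totalCharge, intSign_sum,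
      ← Finset.prod_pow_eq_pow_sum]
    rfl

/-- For a mode in `a`, the parity of its charge flips, so the tensor sign changes by the sign of the
charge of `M + 1, …, M + N`. This cancels the Koszul sign for passing those factors. For the factors
`1, …, M` neither sign involves them. -/
theorem tensorSign_left {s : State (M + N + 2)} {i : Fin (M + 1)} {r : ℤ}
    (h : r ∉ (s (leftSlot M N i)).carrier) :
    opSign K s (leftSlot M N i) r * tensorSign K (addMode s (leftSlot M N i) r) =
      tensorSign K s * opSign K (s ∘ leftSlot M N) i r := by
  have hmid : middle (addMode s (leftSlot M N i) r) = middle s :=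
    addMode_comp_of_notMem s (fun j => by
      rw [← rightSlot_castAdd]; exact (leftSlot_ne_rightSlot _ _).symm) r
  unfold tensorSign
  rw [hmid, opSign_eq_prod, opSign_eq_prod, Fin.prod_univ_add, Fin.prod_univ_add,
    Fin.prod_univ_add, Fin.prod_univ_two]
  revert h
  refine Fin.addCases (fun i => ?_) (fun i => ?_) i
  · intro h
    have h1 : (addMode s (leftSlot M N (Fin.castAdd 1 i)) r) (Fin.natAdd (M + N) (0 : Fin 2)) =
        s (Fin.natAdd (M + N) (0 : Fin 2)) := by
      rw [addMode, Function.update_of_ne]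
      rw [leftSlot_castAdd, Ne, Fin.ext_iff]
      simp only [Fin.val_natAdd, Fin.val_castAdd, Fin.val_zero]
      omega
    rw [h1]
    have h2 : ∀ j : Fin N, ¬ (M + (j : ℕ) < i) := fun j => by omega
    have h3 : ¬ (M + N < (i : ℕ)) := by omega
    have h4 : ¬ (M + N + 1 < (i : ℕ)) := by omega
    have h5 : ¬ (M < (i : ℕ)) := by omega
    simp only [leftSlot_castAdd, leftSlot_natAdd, Fin.lt_def, Fin.val_castAdd, Fin.val_natAdd,
      Function.comp_apply, h2, h3, h4, h5, if_false, Finset.prod_const_one, mul_one, Fin.val_zero,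
      Fin.val_one, add_zero, Finset.univ_unique, Finset.prod_singleton, Fin.default_eq_zero]
    ring
  · intro h
    rw [leftSlot_natAdd] at h ⊢
    have h1 : ((addMode s (Fin.natAdd (M + N) (0 : Fin 2)) r)
        (Fin.natAdd (M + N) (0 : Fin 2))).charge =
        (s (Fin.natAdd (M + N) (0 : Fin 2))).charge + 1 := by
      rw [addMode, Function.update_self, AdmissibleSet.charge_insert h]
    have h2 : ∀ j : Fin N, M + (j : ℕ) < M + N := fun j => by omega
    have h3 : ∀ j : Fin M, (j : ℕ) < M + N := fun j => by omega
    have h4 : ∀ j : Fin M, (j : ℕ) < M := fun j => by omega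
    have h5 : intSign K (totalCharge (middle s)) * intSign K (totalCharge (middle s)) = 1 :=
      intSign_mul_self _
    have h6 : ∏ j : Fin N, intSign K (s (Fin.castAdd 2 (Fin.natAdd M j))).charge =
        intSign K (totalCharge (middle s)) := (intSign_sum _ _).symm
    rw [h1]
    simp only [leftSlot_castAdd, leftSlot_natAdd, Fin.lt_def, Fin.val_castAdd, Fin.val_natAdd,
      Function.comp_apply, h2, h3, h4, if_true, Finset.prod_const_one, mul_one, Fin.val_zero,
      Fin.val_one, add_zero, Finset.univ_unique, Fin.default_eq_zero,
      Int.even_add_one, lt_irrefl, if_false, Fin.val_eq_zero, h6]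
    by_cases he : Even (s (Fin.natAdd (M + N) (0 : Fin 2))).charge
    · simp only [he, not_true_eq_false, if_true, if_false]
      rw [if_neg (by omega)]
      linear_combination (∏ j : Fin M, intSign K (s (Fin.castAdd 2 (Fin.castAdd N j))).charge) *
        (-1) ^ (s (Fin.natAdd (M + N) (0 : Fin 2))).above r * h5
    · simp only [he, not_false_eq_true, if_true, if_false]
      rw [if_neg (by omega)]
      ring

/-- The extra factor is the Koszul sign for passing `1, …, M, a`. The share of `1, …, M` comes from
`opSign`; the share of `a` comes from the change of the tensor sign for the factors `M + 1, …, M +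
N`, and from `opSign` for `b`. -/
theorem tensorSign_right {s : State (M + N + 2)} {j : Fin (N + 1)} {r : ℤ}
    (h : r ∉ (s (rightSlot M N j)).carrier) :
    opSign K s (rightSlot M N j) r * tensorSign K (addMode s (rightSlot M N j) r) =
      intSign K (totalCharge (s ∘ leftSlot M N)) * tensorSign K s *
        opSign K (s ∘ rightSlot M N) j r := by
  have h1 : (addMode s (rightSlot M N j) r) (Fin.natAdd (M + N) (0 : Fin 2)) =
      s (Fin.natAdd (M + N) (0 : Fin 2)) := by
    rw [addMode, Function.update_of_ne]
    rw [← leftSlot_natAdd 0]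
    exact leftSlot_ne_rightSlot _ _
  unfold tensorSign
  rw [h1, opSign_eq_prod, opSign_eq_prod, Fin.prod_univ_add, Fin.prod_univ_add,
    Fin.prod_univ_add, Fin.prod_univ_two,
    show intSign K (totalCharge (s ∘ leftSlot M N)) = _ from intSign_sum _ _, Fin.prod_univ_add]
  clear h1
  have h0 : intSign K (s (Fin.natAdd (M + N) (0 : Fin 2))).charge =
    if Even (s (Fin.natAdd (M + N) (0 : Fin 2))).charge then 1 else -1 := intSign_eq _
  revert h
  refine Fin.addCases (fun i => ?_) (fun i => ?_) j
  · intro h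
    have hinj : Function.Injective fun j : Fin N => (Fin.castAdd 2 (Fin.natAdd M j)) :=
      fun a b hab => by simpa [Fin.ext_iff] using hab
    have hmid : middle (addMode s (rightSlot M N (Fin.castAdd 1 i)) r) =
        addMode (middle s) i r := by
      rw [rightSlot_castAdd]
      exact addMode_comp hinj s i r
    rw [rightSlot_castAdd] at h
    rw [hmid, totalCharge_addMode (s := middle s) h, intSign_add_one]
    have h2 : ∀ j : Fin M, (j : ℕ) < M + i := fun j => by omega
    have h3 : ¬ (M + N < M + (i : ℕ)) := by omega
    have h4 : ¬ (M + N + 1 < M + (i : ℕ)) := by omega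
    have h5 : ¬ (N < (i : ℕ)) := by omega
    simp only [leftSlot_castAdd, leftSlot_natAdd, rightSlot_castAdd, rightSlot_natAdd, Fin.lt_def,
      Fin.val_castAdd, Fin.val_natAdd, Function.comp_apply, h2, h3, h4, h5, if_true, if_false,
      mul_one, Fin.val_zero, Fin.val_one, add_zero, Finset.univ_unique,
      Finset.prod_singleton, Fin.default_eq_zero, add_lt_add_iff_left, h0]
    split_ifs <;> ring
  · intro h
    have hmid : middle (addMode s (rightSlot M N (Fin.natAdd N i)) r) = middle s :=
      addMode_comp_of_notMem s (fun j => by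
        rw [rightSlot_natAdd, Ne, Fin.ext_iff]
        simp only [Fin.val_natAdd, Fin.val_castAdd, Fin.val_one]
        omega) r
    rw [hmid]
    have h2 : ∀ j : Fin N, M + (j : ℕ) < M + N + 1 := fun j => by omega
    have h3 : ∀ j : Fin M, (j : ℕ) < M + N + 1 := fun j => by omega
    have h4 : M + N < M + N + 1 := by omega
    have h5 : ∀ j : Fin N, (j : ℕ) < N := fun j => by omega
    simp only [leftSlot_castAdd, leftSlot_natAdd, rightSlot_castAdd, rightSlot_natAdd, Fin.lt_def,
      Fin.val_castAdd, Fin.val_natAdd, Function.comp_apply, h2, h3, h4, h5, if_true, if_false,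
      Finset.prod_const_one, mul_one, Fin.val_zero, Fin.val_one, add_zero, Finset.univ_unique,
      Finset.prod_singleton, Fin.default_eq_zero, lt_irrefl, Fin.val_eq_zero]
    ring

theorem psiStar_tensor_left (V₁ : FockVector K (M + 1)) (V₂ : FockVector K (N + 1))
    (i : Fin (M + 1)) (r : ℤ) (s : State (M + N + 2)) :
    psiStar (leftSlot M N i) r (tensor V₁ V₂) s =
      tensorSign K s * (psiStar i r V₁ (s ∘ leftSlot M N) * V₂ (s ∘ rightSlot M N)) := by
  by_cases h : r ∈ (s (leftSlot M N i)).carrier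
  · rw [psiStar_of_mem h, psiStar_of_mem (s := s ∘ leftSlot M N) h]
    simp
  · rw [psiStar_of_notMem h, psiStar_of_notMem (s := s ∘ leftSlot M N) h, tensor_apply,
      addMode_comp leftSlot_injective,
      addMode_comp_of_notMem s (fun j => (leftSlot_ne_rightSlot _ _).symm), ← mul_assoc,
      tensorSign_left h]
    ring

theorem psiStar_tensor_right (V₁ : FockVector K (M + 1)) (V₂ : FockVector K (N + 1))
    (j : Fin (N + 1)) (r : ℤ) (s : State (M + N + 2)) :
    psiStar (rightSlot M N j) r (tensor V₁ V₂) s =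
      intSign K (totalCharge (s ∘ leftSlot M N)) * tensorSign K s *
        (V₁ (s ∘ leftSlot M N) * psiStar j r V₂ (s ∘ rightSlot M N)) := by
  by_cases h : r ∈ (s (rightSlot M N j)).carrier
  · rw [psiStar_of_mem h, psiStar_of_mem (s := s ∘ rightSlot M N) h]
    simp
  · rw [psiStar_of_notMem h, psiStar_of_notMem (s := s ∘ rightSlot M N) h, tensor_apply,
      addMode_comp rightSlot_injective,
      addMode_comp_of_notMem s (fun j => leftSlot_ne_rightSlot _ _), ← mul_assoc,
      tensorSign_right h]
    ring

theorem sum_modes_slots {α : Type*} [AddCommMonoid α] (B : ℕ) (f : Fin (M + N + 2) × ℕ → α) :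
    ∑ h ∈ modes (M + N + 2) B, f h =
      ∑ h ∈ modes (M + 1) B, f (leftSlot M N h.1, h.2) +
        ∑ h ∈ modes (N + 1) B, f (rightSlot M N h.1, h.2) := by
  simp only [modes, Finset.sum_product]
  exact sum_slots _

section Coefficients

variable (A₁ : Fin (M + 1) → Fin (M + 1) → ℕ → ℕ → K) (A₂ : Fin (N + 1) → Fin (N + 1) → ℕ → ℕ → K)

theorem tensorCoeff_left_left (i j : Fin (M + 1)) :
    tensorCoeff A₁ A₂ (leftSlot M N i) (leftSlot M N j) = A₁ i j := by
  funext m n; simp [tensorCoeff, splitSlot_leftSlot]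

theorem tensorCoeff_right_right (i j : Fin (N + 1)) :
    tensorCoeff A₁ A₂ (rightSlot M N i) (rightSlot M N j) = A₂ i j := by
  funext m n; simp [tensorCoeff, splitSlot_rightSlot]

theorem tensorCoeff_left_right (i : Fin (M + 1)) (j : Fin (N + 1)) :
    tensorCoeff A₁ A₂ (leftSlot M N i) (rightSlot M N j) = 0 := by
  funext m n; simp [tensorCoeff, splitSlot_leftSlot, splitSlot_rightSlot]

theorem tensorCoeff_right_left (i : Fin (N + 1)) (j : Fin (M + 1)) :
    tensorCoeff A₁ A₂ (rightSlot M N i) (leftSlot M N j) = 0 := by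
  funext m n; simp [tensorCoeff, splitSlot_leftSlot, splitSlot_rightSlot]

variable [Algebra ℚ K]

/-- With block-diagonal coefficients each contraction identity involves the slots of one factor
only. The Koszul sign on the right slots depends on the state but not on the mode, so it is the same
on both sides. -/
theorem tensor_bogoliubov :
    tensor (bogoliubov A₁) (bogoliubov A₂) = bogoliubov (tensorCoeff A₁ A₂) := by
  refine eq_bogoliubov (fun p m => ?_) (fun s hs => ?_) ?_
  · funext s
    obtain ⟨B, hB⟩ := exists_boundedBy s
    rw [contractHoles_eq_sum _ p m _ hB, sum_modes_slots]
    obtain ⟨i | j, rfl⟩ := (slotEquiv M N).surjective p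
    · change psiStar (leftSlot M N i) (m : ℤ) _ s = ∑ h ∈ modes (M + 1) B,
        tensorCoeff A₁ A₂ (leftSlot M N i) _ _ _ * _ + ∑ h ∈ modes (N + 1) B,
        tensorCoeff A₁ A₂ (leftSlot M N i) _ _ _ * _
      simp only [tensorCoeff_left_left, tensorCoeff_left_right, psiStar_tensor_left, Pi.zero_apply,
        zero_mul, Finset.sum_const_zero, add_zero]
      rw [psiStar_bogoliubov, contractHoles_eq_sum _ i m _ (hB.comp _), Finset.sum_mul,
        Finset.mul_sum]
      exact Finset.sum_congr rfl fun h _ => by ring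
    · change psiStar (rightSlot M N j) (m : ℤ) _ s = ∑ h ∈ modes (M + 1) B,
        tensorCoeff A₁ A₂ (rightSlot M N j) _ _ _ * _ + ∑ h ∈ modes (N + 1) B,
        tensorCoeff A₁ A₂ (rightSlot M N j) _ _ _ * _
      simp only [tensorCoeff_right_left, tensorCoeff_right_right, psiStar_tensor_right,
        Pi.zero_apply, zero_mul, Finset.sum_const_zero, zero_add]
      rw [psiStar_bogoliubov, contractHoles_eq_sum _ j m _ (hB.comp _), Finset.mul_sum,
        Finset.mul_sum]
      exact Finset.sum_congr rfl fun h _ => by ring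
  · have h1 : totalCharge s =
        totalCharge (s ∘ leftSlot M N) + totalCharge (s ∘ rightSlot M N) := sum_slots _
    rw [tensor_apply]
    by_cases h2 : totalCharge (s ∘ leftSlot M N) = 0
    · rw [bogoliubov_eq_zero_of_totalCharge A₂ (by omega), mul_zero, mul_zero]
    · rw [bogoliubov_eq_zero_of_totalCharge A₁ h2, zero_mul, mul_zero]
  · rw [tensor_apply]
    have h1 : bogoliubov A₁ ((fun _ => AdmissibleSet.vacuum) ∘ leftSlot M N) = 1 :=
      bogoliubov_vacuum A₁
    have h2 : bogoliubov A₂ ((fun _ => AdmissibleSet.vacuum) ∘ rightSlot M N) = 1 :=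
      bogoliubov_vacuum A₂
    rw [h1, h2]
    simp [tensorSign]

end Coefficients

end Tensor

/-! ### Splitting off the last factors. -/

section Append

variable {K : Type*} [CommRing K] {M L : ℕ}

theorem addMode_append_castAdd (s : State M) (t : State L) (i : Fin M) (r : ℤ) :
    addMode (Fin.append s t) (Fin.castAdd L i) r = Fin.append (addMode s i r) t :=
  State.ext_mem fun j q => by
    rw [mem_addMode]
    refine Fin.addCases (fun j => ?_) (fun j => ?_) j
    · rw [Fin.append_left, Fin.append_left, mem_addMode, (Fin.castAdd_injective M L).eq_iff]
    · rw [Fin.append_right, Fin.append_right, or_iff_right]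
      rintro ⟨h, -⟩
      rw [Fin.ext_iff, Fin.val_natAdd, Fin.val_castAdd] at h
      omega

theorem addMode_append_natAdd (s : State M) (t : State L) (j : Fin L) (r : ℤ) :
    addMode (Fin.append s t) (Fin.natAdd M j) r = Fin.append s (addMode t j r) :=
  State.ext_mem fun k q => by
    rw [mem_addMode]
    refine Fin.addCases (fun k => ?_) (fun k => ?_) k
    · rw [Fin.append_left, Fin.append_left, or_iff_right]
      rintro ⟨h, -⟩
      rw [Fin.ext_iff, Fin.val_natAdd, Fin.val_castAdd] at h
      omega
    · rw [Fin.append_right, Fin.append_right, mem_addMode, (Fin.natAdd_injective L M).eq_iff]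

theorem opSign_append_castAdd (s : State M) (t : State L) (i : Fin M) (r : ℤ) :
    opSign K (Fin.append s t) (Fin.castAdd L i) r = opSign K s i r := by
  have h : ∀ j : Fin L, ¬ (M + (j : ℕ) < i) := fun j => by omega
  rw [opSign_eq_prod, opSign_eq_prod, Fin.prod_univ_add]
  simp [Fin.lt_def, h, -Fin.val_fin_lt]

theorem opSign_append_natAdd (s : State M) (t : State L) (j : Fin L) (r : ℤ) :
    opSign K (Fin.append s t) (Fin.natAdd M j) r = intSign K (totalCharge s) * opSign K t j r := by
  have h : ∀ i : Fin M, (i : ℕ) < M + j := fun i => by omega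
  rw [opSign_eq_prod, opSign_eq_prod, Fin.prod_univ_add, totalCharge, intSign_sum]
  simp [Fin.lt_def, h, mul_assoc, -Fin.val_fin_lt]

theorem totalCharge_append (s : State M) (t : State L) :
    totalCharge (Fin.append s t) = totalCharge s + totalCharge t := by
  simp [totalCharge, Fin.sum_univ_add]

theorem BoundedBy.append {B : ℕ} {s : State M} {t : State L} (hs : BoundedBy B s)
    (ht : BoundedBy B t) : BoundedBy B (Fin.append s t) := fun k => by
  refine Fin.addCases (fun k => ?_) (fun k => ?_) k
  · rw [Fin.append_left]; exact hs k
  · rw [Fin.append_right]; exact ht k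

theorem psiStar_append_castAdd (v : FockVector K (M + L)) (s : State M) (t : State L)
    (i : Fin M) (r : ℤ) :
    psiStar (Fin.castAdd L i) r v (Fin.append s t) =
      psiStar i r (fun s' => v (Fin.append s' t)) s := by
  by_cases h : r ∈ (s i).carrier
  · rw [psiStar_of_mem h, psiStar_of_mem (by rwa [Fin.append_left])]
  · rw [psiStar_of_notMem h, psiStar_of_notMem (by rwa [Fin.append_left]),
      opSign_append_castAdd, addMode_append_castAdd]

theorem psiStar_append_natAdd (v : FockVector K (M + L)) (s : State M) (t : State L)
    (j : Fin L) (r : ℤ) :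
    psiStar (Fin.natAdd M j) r v (Fin.append s t) =
      intSign K (totalCharge s) * psiStar j r (fun t' => v (Fin.append s t')) t := by
  by_cases h : r ∈ (t j).carrier
  · rw [psiStar_of_mem h, psiStar_of_mem (by rwa [Fin.append_right]), mul_zero]
  · rw [psiStar_of_notMem h, psiStar_of_notMem (by rwa [Fin.append_right]),
      opSign_append_natAdd, addMode_append_natAdd, mul_assoc]

theorem sum_modes_add {α : Type*} [AddCommMonoid α] (B : ℕ) (f : Fin (M + L) × ℕ → α) :
    ∑ h ∈ modes (M + L) B, f h =
      ∑ h ∈ modes M B, f (Fin.castAdd L h.1, h.2) +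
        ∑ h ∈ modes L B, f (Fin.natAdd M h.1, h.2) := by
  simp only [modes, Finset.sum_product]
  exact Fin.sum_univ_add _

theorem boundedBy_vacuum : BoundedBy 0 (fun _ : Fin M => AdmissibleSet.vacuum) := fun _ =>
  ⟨fun m _ h => by rw [AdmissibleSet.mem_vacuum] at h; omega,
    fun n _ => by rw [AdmissibleSet.mem_vacuum]; omega⟩

theorem append_vacuum : Fin.append (fun _ : Fin M => AdmissibleSet.vacuum)
    (fun _ : Fin L => AdmissibleSet.vacuum) = fun _ => AdmissibleSet.vacuum := by
  funext k
  refine Fin.addCases (fun k => ?_) (fun k => ?_) k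
  · rw [Fin.append_left]
  · rw [Fin.append_right]

/-- When the first factors are in the vacuum, all their negative modes are filled and
`ψ^*_{-(n+1/2)}` on them gives zero. Only the block of `A` on the last factors survives. This
identifies the closed part with the vacuum coefficient of the gluing. -/
theorem bogoliubov_append_vacuum [Algebra ℚ K]
    (A : Fin (M + L) → Fin (M + L) → ℕ → ℕ → K) :
    (fun t : State L => bogoliubov A (Fin.append (fun _ : Fin M => AdmissibleSet.vacuum) t)) =
      bogoliubov fun i j => A (Fin.natAdd M i) (Fin.natAdd M j) := by
  have hstar : ∀ (j : Fin L) (r : ℤ) (t : State L), psiStar (Fin.natAdd M j) r (bogoliubov A)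
      (Fin.append (fun _ : Fin M => AdmissibleSet.vacuum) t) = psiStar j r
        (fun t => bogoliubov A (Fin.append (fun _ : Fin M => AdmissibleSet.vacuum) t)) t := by
    intro j r t
    rw [psiStar_append_natAdd, totalCharge_vacuum, intSign_zero, one_mul]
  refine eq_bogoliubov (fun j m => ?_) (fun t ht => ?_) ?_
  · funext t
    obtain ⟨B, hB⟩ := exists_boundedBy t
    rw [← hstar, psiStar_bogoliubov, contractHoles_eq_sum A _ m _
      ((boundedBy_vacuum.mono (Nat.zero_le B)).append hB), contractHoles_eq_sum _ j m _ hB,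
      sum_modes_add]
    simp only [hstar]
    rw [Finset.sum_eq_zero, zero_add]
    intro h _
    rw [psiStar_of_mem, mul_zero]
    rw [Fin.append_left, AdmissibleSet.mem_vacuum]
    omega
  · refine bogoliubov_eq_zero_of_totalCharge A ?_
    rwa [totalCharge_append, totalCharge_vacuum, zero_add]
  · rw [append_vacuum, bogoliubov_vacuum]

end Append

/-! ### Finite support when only finitely many modes are coupled. -/

section BoundedSupport

variable {K : Type*} [CommRing K] {N : ℕ}

theorem finite_boundedBy (N d : ℕ) : {t : State N | BoundedBy d t}.Finite := by
  refine Set.Finite.of_injOn (f := fun t : State N => fun i => (t i).carrier ∩ Set.Ico (-(d : ℤ)) d)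
    (t := Set.pi Set.univ fun _ => {b | b ⊆ Set.Ico (-(d : ℤ)) d}) ?_ ?_
    (Set.Finite.pi fun _ => (Set.finite_Ico _ _).finite_subsets)
  · intro t _ i _
    exact Set.inter_subset_right
  · intro s hs t ht hst
    refine State.ext_mem fun i r => ?_
    have h1 : r ∈ (s i).carrier ∩ Set.Ico (-(d : ℤ)) d ↔
        r ∈ (t i).carrier ∩ Set.Ico (-(d : ℤ)) d := Set.ext_iff.1 (congrFun hst i) r
    by_cases hr : r ∈ Set.Ico (-(d : ℤ)) d
    · simpa [hr.1, hr.2] using h1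
    by_cases h0 : 0 ≤ r
    · obtain ⟨m, rfl⟩ := Int.eq_ofNat_of_zero_le h0
      have hm : d ≤ m := by
        by_contra hc
        exact hr ⟨by omega, by omega⟩
      exact iff_of_false ((hs i).1 m hm) ((ht i).1 m hm)
    · obtain ⟨n, rfl⟩ : ∃ n : ℕ, r = -(n : ℤ) - 1 := ⟨(-r - 1).toNat, by omega⟩
      have hn : d ≤ n := by
        by_contra hc
        exact hr ⟨by omega, by omega⟩
      exact iff_of_true ((hs i).2 n hn) ((ht i).2 n hn)

/-- The finite set of states with all particles and holes in `[-d, d)`. -/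
def boundedStates (N d : ℕ) : Finset (State N) := (finite_boundedBy N d).toFinset

theorem mem_boundedStates {d : ℕ} {t : State N} : t ∈ boundedStates N d ↔ BoundedBy d t :=
  Set.Finite.mem_toFinset _

/-- If the coefficient at `t` is nonzero, expansion along a particle has a nonzero term. Its
coefficient of `E` puts both the particle and the hole inside the window, and the state without this
pair is bounded by induction. -/
theorem boundedBy_of_bogoliubov_ne_zero [Algebra ℚ K] {E : Fin N → Fin N → ℕ → ℕ → K} {d : ℕ}
    (hE : ∀ i j m n, d ≤ m ∨ d ≤ n → E i j m n = 0) (t : State N) (h : bogoliubov E t ≠ 0) :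
    BoundedBy d t := by
  induction hk : particles t using Nat.strong_induction_on generalizing t with
  | _ k ih =>
    by_cases hp : particles t = 0
    · rw [eq_vacuum_of_particles_eq_zero hp (totalCharge_eq_zero_of_bogoliubov_ne_zero E h)]
      exact boundedBy_vacuum.mono (Nat.zero_le d)
    obtain ⟨i, m, hm⟩ := exists_particle hp
    rw [expand_particle (psiStar_bogoliubov E i m) hm] at h
    obtain ⟨q, hq⟩ : ∃ q : Fin N × ℕ, E i q.1 m q.2 *
        psiStar q.1 (-(q.2 : ℤ) - 1) (bogoliubov E) (removeMode t i m) ≠ 0 := by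
      by_contra! hc
      exact h (by rw [contractHoles, finsum_eq_zero_of_forall_eq_zero hc, mul_zero])
    have hEq := left_ne_zero_of_mul hq
    have hmd : m < d := by
      by_contra hc
      exact hEq (hE _ _ _ _ (Or.inl (not_lt.1 hc)))
    have hqd : q.2 < d := by
      by_contra hc
      exact hEq (hE _ _ _ _ (Or.inr (not_lt.1 hc)))
    have hstar := right_ne_zero_of_mul hq
    have hmem : (-(q.2 : ℤ) - 1) ∉ (removeMode t i m q.1).carrier := fun hc =>
      hstar (psiStar_of_mem hc _)
    rw [psiStar_of_notMem hmem] at hstar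
    have hb := ih _ (by
      rw [← hk]
      exact (particles_addMode_neg _ _ _).trans_lt (particles_removeMode hm)) _
      (right_ne_zero_of_mul hstar) rfl
    have hb' := (hb.removeMode q.1 (r := -(q.2 : ℤ) - 1) (by omega)).addMode i
      (r := m) (by omega)
    rwa [removeMode_addMode hmem, addMode_removeMode hm] at hb'

end BoundedSupport

/-! ### The inner product with a vector of bounded support. -/

section Pairing

variable {K : Type*} [CommRing K] {M L : ℕ}

/-- The inner product of `v` and `w` over the last `L` components. -/
def pairing (v : FockVector K (M + L)) (w : FockVector K L) : FockVector K M :=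
  fun s => ∑ᶠ t : State L, v (Fin.append s t) * w t

theorem pairing_eq_sum {d : ℕ} {w : FockVector K L} (hw : ∀ t, w t ≠ 0 → BoundedBy d t)
    (v : FockVector K (M + L)) (s : State M) :
    pairing v w s = ∑ t ∈ boundedStates L d, v (Fin.append s t) * w t :=
  finsum_eq_sum_of_support_subset _ fun t ht =>
    Finset.mem_coe.2 (mem_boundedStates.2 (hw t (right_ne_zero_of_mul ht)))

open Classical in
/-- `t` with the occupation of the mode `(j, r)` switched. -/
def toggleMode (j : Fin L) (r : ℤ) (t : State L) : State L :=
  if r ∈ (t j).carrier then removeMode t j r else addMode t j r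

theorem toggleMode_involutive (j : Fin L) (r : ℤ) :
    Function.Involutive (toggleMode j r) := fun t => by
  by_cases h : r ∈ (t j).carrier
  · have h1 : r ∉ (removeMode t j r j).carrier := by simp [mem_removeMode]
    rw [toggleMode, toggleMode, if_pos h, if_neg h1, addMode_removeMode h]
  · have h1 : r ∈ (addMode t j r j).carrier := by simp [mem_addMode]
    rw [toggleMode, toggleMode, if_neg h, if_pos h1, removeMode_addMode h]

/-- Adjointness of `ψ` and `ψ^*`: switching the mode `(j, r)` is a bijection of states that matches
the terms of the two sums. The sign is the Koszul sign of the first `M` factors. -/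
theorem pairing_psiStar_natAdd (v : FockVector K (M + L)) (w : FockVector K L) (j : Fin L) (r : ℤ)
    (s : State M) :
    pairing (psiStar (Fin.natAdd M j) r v) w s =
      intSign K (totalCharge s) * pairing v (psi j r w) s := by
  have h1 : ∀ t, psiStar (Fin.natAdd M j) r v (Fin.append s t) * w t =
      intSign K (totalCharge s) * (v (Fin.append s (toggleMode j r t)) *
        psi j r w (toggleMode j r t)) := by
    intro t
    rw [psiStar_append_natAdd]
    by_cases h : r ∈ (t j).carrier
    · rw [psiStar_of_mem h, toggleMode, if_pos h, psi_of_notMem (by simp [mem_removeMode])]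
      simp
    · rw [psiStar_of_notMem h, toggleMode, if_neg h, psi_of_mem (by simp [mem_addMode]),
        removeMode_addMode h, opSign_addMode h, crossSign_self]
      ring
  have h2 : ∑ᶠ t, v (Fin.append s (toggleMode j r t)) * psi j r w (toggleMode j r t) =
      pairing v (psi j r w) s :=
    finsum_comp_equiv (toggleMode_involutive j r).toPerm
      (f := fun t => v (Fin.append s t) * psi j r w t)
  -- Splitting into the signs `1` and `-1` lets the constant leave the sum without a finiteness
  -- assumption.
  rw [← h2, pairing, finsum_congr h1, intSign_eq]
  split_ifs
  · simp
  · simp [finsum_neg_distrib]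

theorem pairing_psiStar_castAdd {d : ℕ} {w : FockVector K L}
    (hw : ∀ t, w t ≠ 0 → BoundedBy d t) (v : FockVector K (M + L)) (i : Fin M) (r : ℤ)
    (s : State M) :
    pairing (psiStar (Fin.castAdd L i) r v) w s = psiStar i r (pairing v w) s := by
  rw [pairing_eq_sum hw]
  simp only [psiStar_append_castAdd]
  by_cases h : r ∈ (s i).carrier
  · rw [psiStar_of_mem h]
    exact Finset.sum_eq_zero fun t _ => by rw [psiStar_of_mem h, zero_mul]
  · rw [psiStar_of_notMem h, pairing_eq_sum hw, Finset.mul_sum]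
    exact Finset.sum_congr rfl fun t _ => by rw [psiStar_of_notMem h, mul_assoc]

variable [Algebra ℚ K]

theorem pairing_bogoliubov_of_totalCharge (A : Fin (M + L) → Fin (M + L) → ℕ → ℕ → K)
    (E : Fin L → Fin L → ℕ → ℕ → K) {s : State M} (hs : totalCharge s ≠ 0) :
    pairing (bogoliubov A) (bogoliubov E) s = 0 := by
  refine finsum_eq_zero_of_forall_eq_zero fun t => ?_
  by_cases ht : totalCharge t = 0
  · rw [bogoliubov_eq_zero_of_totalCharge A, zero_mul]
    rwa [totalCharge_append, ht, add_zero]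
  · rw [bogoliubov_eq_zero_of_totalCharge E ht, mul_zero]

section Contraction

variable {A : Fin (M + L) → Fin (M + L) → ℕ → ℕ → K} {E : Fin L → Fin L → ℕ → ℕ → K} {d : ℕ}

theorem pairing_psiStar_bogoliubov (hE : ∀ i j m n, d ≤ m ∨ d ≤ n → E i j m n = 0)
    (q : Fin (M + L)) (m : ℕ) {s : State M} {B : ℕ} (hB : BoundedBy B s) (hd : d ≤ B) :
    pairing (psiStar q (m : ℤ) (bogoliubov A)) (bogoliubov E) s =
      ∑ h ∈ modes M B, A q (Fin.castAdd L h.1) m h.2 *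
        psiStar h.1 (-(h.2 : ℤ) - 1) (pairing (bogoliubov A) (bogoliubov E)) s +
      ∑ h ∈ modes L B, A q (Fin.natAdd M h.1) m h.2 *
        pairing (psiStar (Fin.natAdd M h.1) (-(h.2 : ℤ) - 1) (bogoliubov A)) (bogoliubov E) s := by
  have hP := boundedBy_of_bogoliubov_ne_zero hE
  have h1 : pairing (psiStar q (m : ℤ) (bogoliubov A)) (bogoliubov E) s =
      ∑ h ∈ modes (M + L) B, A q h.1 m h.2 *
        pairing (psiStar h.1 (-(h.2 : ℤ) - 1) (bogoliubov A)) (bogoliubov E) s := by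
    simp only [pairing_eq_sum hP, Finset.mul_sum]
    rw [Finset.sum_comm]
    refine Finset.sum_congr rfl fun t ht => ?_
    rw [psiStar_bogoliubov, contractHoles_eq_sum A q m _
      (hB.append ((mem_boundedStates.1 ht).mono hd)), Finset.sum_mul]
    exact Finset.sum_congr rfl fun h _ => mul_assoc _ _ _
  rw [h1, sum_modes_add]
  simp only [pairing_psiStar_castAdd hP]

/-- Move `ψ^*` across the pairing to a `ψ` on the glued vector, turn it there into particle creators
by `psi_bogoliubov`, and move these back. The two Koszul signs agree, so neither remains. -/
theorem pairing_psiStar_hole (hE : ∀ i j m n, d ≤ m ∨ d ≤ n → E i j m n = 0) (j : Fin L) (n : ℕ)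
    (s : State M) :
    pairing (psiStar (Fin.natAdd M j) (-(n : ℤ) - 1) (bogoliubov A)) (bogoliubov E) s =
      -∑ p ∈ modes L d, E p.1 j p.2 n *
        pairing (psiStar (Fin.natAdd M p.1) (p.2 : ℤ) (bogoliubov A)) (bogoliubov E) s := by
  have hP := boundedBy_of_bogoliubov_ne_zero hE
  have hP' : ∀ p ∈ modes L d, ∀ t, psi p.1 (p.2 : ℤ) (bogoliubov E) t ≠ 0 → BoundedBy d t := by
    intro p hp t ht
    have hm : (p.2 : ℤ) ∈ (t p.1).carrier := by
      by_contra hc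
      exact ht (psi_of_notMem hc _)
    rw [psi_of_mem hm] at ht
    have := (hP _ (right_ne_zero_of_mul ht)).addMode p.1 (r := p.2)
      (by have := mem_modes.1 hp; omega)
    rwa [addMode_removeMode hm] at this
  have h1 : ∀ t, psi j (-(n : ℤ) - 1) (bogoliubov E) t =
      -∑ p ∈ modes L d, E p.1 j p.2 n * psi p.1 (p.2 : ℤ) (bogoliubov E) t := by
    intro t
    rw [psi_bogoliubov, Pi.neg_apply, contractParticles, finsum_eq_sum_of_support_subset]
    intro p hp
    rw [Finset.mem_coe, mem_modes]
    by_contra hc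
    exact hp (by simp only [hE p.1 j p.2 n (Or.inl (not_lt.1 hc)), zero_mul])
  have h2 : ∀ t, psi j (-(n : ℤ) - 1) (bogoliubov E) t ≠ 0 → BoundedBy d t := by
    intro t ht
    rw [h1] at ht
    obtain ⟨p, hp, hpt⟩ := Finset.exists_ne_zero_of_sum_ne_zero (neg_ne_zero.1 ht)
    exact hP' p hp t (right_ne_zero_of_mul hpt)
  rw [pairing_psiStar_natAdd, pairing_eq_sum h2]
  simp only [pairing_psiStar_natAdd, h1, mul_neg, Finset.sum_neg_distrib, Finset.mul_sum]
  rw [Finset.sum_comm]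
  congr 1
  refine Finset.sum_congr rfl fun p hp => ?_
  rw [pairing_eq_sum (hP' p hp), Finset.mul_sum, Finset.mul_sum]
  exact Finset.sum_congr rfl fun t _ => by ring

/-- The matrix `1 + Eᵀ A` on the glued modes below `d`. -/
def gluingMatrix (A : Fin (M + L) → Fin (M + L) → ℕ → ℕ → K) (E : Fin L → Fin L → ℕ → ℕ → K)
    (d : ℕ) : Matrix (modes L d) (modes L d) K :=
  1 + (Matrix.of fun h p : modes L d => E p.1.1 h.1.1 p.1.2 h.1.2) *
    Matrix.of fun p h : modes L d =>
      A (Fin.natAdd M p.1.1) (Fin.natAdd M h.1.1) p.1.2 h.1.2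

/-- At a fixed state let `x` and `z` collect the pairings of `ψ^* V` over the glued hole and
particle modes, and `y` the contribution of the remaining factors. Then `z = y + A x` and `x = -Eᵀ
z`, so `(1 + Eᵀ A) x = -Eᵀ y`. Invertibility expresses `x` through `y`. -/
theorem exists_contractHoles_pairing (hE : ∀ i j m n, d ≤ m ∨ d ≤ n → E i j m n = 0)
    (hdet : IsUnit (gluingMatrix A E d).det) :
    ∃ R : Fin M → Fin M → ℕ → ℕ → K, ∀ i (m : ℕ),
      psiStar i (m : ℤ) (pairing (bogoliubov A) (bogoliubov E)) =
        contractHoles R i m (pairing (bogoliubov A) (bogoliubov E)) := by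
  have hP := boundedBy_of_bogoliubov_ne_zero hE
  set G := pairing (bogoliubov A) (bogoliubov E) with hG
  set Et : Matrix (modes L d) (modes L d) K :=
    Matrix.of fun h p : modes L d => E p.1.1 h.1.1 p.1.2 h.1.2 with hEt
  set Ac : Matrix (modes L d) (modes L d) K := Matrix.of fun p h : modes L d =>
      A (Fin.natAdd M p.1.1) (Fin.natAdd M h.1.1) p.1.2 h.1.2 with hAc
  have hmat : gluingMatrix A E d = 1 + Et * Ac := rfl
  set C : Matrix (modes L d) (modes L d) K := -((gluingMatrix A E d)⁻¹ * Et) with hC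
  -- Substituting `x = C y` into the pairing of the contraction identity gives `A + A C A`, with the
  -- blocks external-external, external-glued and glued-external. It does not depend on the state.
  refine ⟨fun i j m n => A (Fin.castAdd L i) (Fin.castAdd L j) m n +
    ∑ k, ∑ p, A (Fin.castAdd L i) (Fin.natAdd M k.1.1) m k.1.2 * C k p *
      A (Fin.natAdd M p.1.1) (Fin.castAdd L j) p.1.2 n, fun i m => ?_⟩
  funext s
  obtain ⟨B₀, hB₀⟩ := exists_boundedBy s
  obtain ⟨B, hB, hd⟩ : ∃ B, BoundedBy B s ∧ d ≤ B := ⟨B₀ + d, hB₀.mono (by omega), by omega⟩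
  set x : Fin L × ℕ → K := fun h =>
    pairing (psiStar (Fin.natAdd M h.1) (-(h.2 : ℤ) - 1) (bogoliubov A)) (bogoliubov E) s with hx
  set y : modes L d → K := fun p => ∑ h ∈ modes M B,
    A (Fin.natAdd M p.1.1) (Fin.castAdd L h.1) p.1.2 h.2 *
      psiStar h.1 (-(h.2 : ℤ) - 1) G s with hy
  -- The window `B` depends on the state, but the unknowns beyond `d` vanish. So the linear system
  -- has the same finite size for every state.
  have hx0 : ∀ h : Fin L × ℕ, d ≤ h.2 → x h = 0 := by
    intro h hh
    rw [hx]
    simp only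
    rw [pairing_psiStar_hole hE, Finset.sum_eq_zero, neg_zero]
    intro p _
    rw [hE _ _ _ _ (Or.inr hh), zero_mul]
  have hsum : ∀ f : Fin L × ℕ → K, ∑ h ∈ modes L B, f h * x h = ∑ h : modes L d, f h.1 * x h.1 := by
    intro f
    rw [Finset.sum_coe_sort (modes L d) fun h => f h * x h]
    symm
    refine Finset.sum_subset (fun h hh => ?_) fun h _ hh => ?_
    · rw [mem_modes] at hh ⊢; omega
    · rw [mem_modes, not_lt] at hh
      rw [hx0 h hh, mul_zero]
  have hz : ∀ p : modes L d,
      pairing (psiStar (Fin.natAdd M p.1.1) (p.1.2 : ℤ) (bogoliubov A)) (bogoliubov E) s =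
        y p + (Ac.mulVec fun h => x h.1) p := by
    intro p
    rw [pairing_psiStar_bogoliubov hE _ _ hB hd]
    congr 1
    exact hsum fun h => A (Fin.natAdd M p.1.1) (Fin.natAdd M h.1) p.1.2 h.2
  have hxy : (fun h : modes L d => x h.1) = -Et.mulVec (y + Ac.mulVec fun h => x h.1) := by
    funext h
    rw [hx]
    simp only
    rw [pairing_psiStar_hole hE, ← Finset.sum_coe_sort]
    simp only [hz]
    rfl
  have hsolve : (fun h : modes L d => x h.1) = C.mulVec y := by
    have h1 : (gluingMatrix A E d).mulVec (fun h : modes L d => x h.1) = -Et.mulVec y := by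
      rw [hmat, Matrix.add_mulVec, Matrix.one_mulVec, ← Matrix.mulVec_mulVec]
      nth_rewrite 1 [hxy]
      rw [Matrix.mulVec_add]
      abel
    have h2 := congrArg ((gluingMatrix A E d)⁻¹).mulVec h1
    rw [Matrix.mulVec_mulVec, Matrix.nonsing_inv_mul _ hdet, Matrix.one_mulVec] at h2
    rw [h2, hC, Matrix.neg_mulVec, Matrix.mulVec_neg, Matrix.mulVec_mulVec]
  rw [hG, ← pairing_psiStar_castAdd hP, ← hG, pairing_psiStar_bogoliubov hE _ _ hB hd,
    contractHoles_eq_sum _ i m _ hB]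
  simp only [add_mul, Finset.sum_add_distrib]
  congr 1
  rw [hsum fun h => A (Fin.castAdd L i) (Fin.natAdd M h.1) m h.2]
  simp only [congrFun hsolve, Matrix.mulVec, dotProduct, hy, Finset.mul_sum, Finset.sum_mul]
  symm
  rw [Finset.sum_comm]
  refine Finset.sum_congr rfl fun k _ => ?_
  rw [Finset.sum_comm]
  exact Finset.sum_congr rfl fun p _ => Finset.sum_congr rfl fun h _ => by ring

end Contraction

end Pairing

/-! ### Recovering the coefficients from the vector. -/

section Coefficients

variable {K : Type*} [CommRing K] [Algebra ℚ K] {N : ℕ}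

/-- The coefficients `A` can be read off from the Bogoliubov transform. -/
theorem coeff_eq_of_bogoliubov (A : Fin N → Fin N → ℕ → ℕ → K) (i j : Fin N) (m n : ℕ) :
    A i j m n =
      opSign K (removeMode (fun _ => AdmissibleSet.vacuum) j (-(n : ℤ) - 1)) j (-(n : ℤ) - 1) *
        psiStar i (m : ℤ) (bogoliubov A)
          (removeMode (fun _ => AdmissibleSet.vacuum) j (-(n : ℤ) - 1)) := by
  have h1 : (-(n : ℤ) - 1) ∉ (removeMode (fun _ : Fin N => AdmissibleSet.vacuum) j
      (-(n : ℤ) - 1) j).carrier := by simp [mem_removeMode]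
  have h2 : (-(n : ℤ) - 1) ∈ ((fun _ : Fin N => AdmissibleSet.vacuum) j).carrier := by
    rw [AdmissibleSet.mem_vacuum]; omega
  -- The state is the vacuum with the single hole `(j, n)`; every other negative mode is filled, so
  -- only one term of the contraction survives.
  rw [psiStar_bogoliubov, contractHoles, finsum_eq_single _ (j, n)]
  · simp only
    rw [psiStar_of_notMem h1, addMode_removeMode h2, bogoliubov_vacuum]
    linear_combination (-A i j m n) * opSign_mul_self (K := K)
      (removeMode (fun _ => AdmissibleSet.vacuum) j (-(n : ℤ) - 1)) j (-(n : ℤ) - 1)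
  · rintro ⟨k, l⟩ hkl
    simp only
    rw [psiStar_of_mem, mul_zero]
    refine mem_removeMode.2 ⟨?_, ?_⟩
    · rw [AdmissibleSet.mem_vacuum]; omega
    · rintro ⟨rfl, h⟩
      exact hkl (Prod.ext rfl (by simp only; omega))

end Coefficients

/-! ### Reduction modulo powers of `Q` and the normalized gluing. -/

section Gluing

variable {R : Type*} [CommRing R]

/-- Reduction of `R[Θ, Θ⁻¹]⟦Q⟧` modulo `Q ^ d`. -/
def reduction (R : Type*) [CommRing R] (d : ℕ) :
    GluingRing R →+* GluingRing R ⧸ Ideal.span {(PowerSeries.X : GluingRing R) ^ d} :=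
  Ideal.Quotient.mk _

theorem reduction_eq_zero_iff {d : ℕ} {x : GluingRing R} :
    reduction R d x = 0 ↔ ∀ k < d, PowerSeries.coeff k x = 0 := by
  rw [reduction, Ideal.Quotient.eq_zero_iff_mem, Ideal.mem_span_singleton,
    PowerSeries.X_pow_dvd_iff]

theorem eq_of_reduction_eq {x y : GluingRing R}
    (h : ∀ d, reduction R d x = reduction R d y) : x = y := by
  refine PowerSeries.ext fun k => ?_
  have h1 := h (k + 1)
  rw [← sub_eq_zero, ← map_sub, reduction_eq_zero_iff] at h1
  have h2 := h1 k (Nat.lt_succ_self k)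
  rwa [map_sub, sub_eq_zero] at h2

/-- The coefficients `Q^{m+n+1} Θ^{ε_{ij}} E^{ij}_{mn}` of the gluing vector. -/
def gluingCoeff (E : Fin 2 → Fin 2 → ℕ → ℕ → GluingRing R) : Fin 2 → Fin 2 → ℕ → ℕ → GluingRing R :=
  fun i j m n => monomialQΘ R (m + n + 1) (gluingExponent i j) * E i j m n

theorem coeff_gluingCoeff (E : Fin 2 → Fin 2 → ℕ → ℕ → GluingRing R) (i j : Fin 2) {m n k : ℕ}
    (hk : k < m + n + 1) : PowerSeries.coeff k (gluingCoeff E i j m n) = 0 := by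
  rw [gluingCoeff, PowerSeries.coeff_mul]
  refine Finset.sum_eq_zero fun p hp => ?_
  rw [Finset.HasAntidiagonal.mem_antidiagonal] at hp
  rw [monomialQΘ, PowerSeries.coeff_monomial, if_neg (by omega), zero_mul]

theorem constantCoeff_gluingCoeff (E : Fin 2 → Fin 2 → ℕ → ℕ → GluingRing R) (i j : Fin 2)
    (m n : ℕ) : PowerSeries.constantCoeff (gluingCoeff E i j m n) = 0 := by
  rw [← PowerSeries.coeff_zero_eq_constantCoeff_apply]
  exact coeff_gluingCoeff E i j (by omega)

/-- The factor `Q^{m+n+1}` turns a bound on the power of `Q` into a bound on the modes. -/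
theorem reduction_gluingCoeff (E : Fin 2 → Fin 2 → ℕ → ℕ → GluingRing R) (d : ℕ) (i j : Fin 2)
    (m n : ℕ) (h : d ≤ m ∨ d ≤ n) : reduction R d (gluingCoeff E i j m n) = 0 :=
  reduction_eq_zero_iff.2 fun k hk => coeff_gluingCoeff E i j (by omega)

/-- Since `m + n + 1 > 0`, the gluing coefficients have no constant term and the matrix is the
identity modulo `Q`. -/
theorem isUnit_det_gluingMatrix {M : ℕ} (E : Fin 2 → Fin 2 → ℕ → ℕ → GluingRing R)
    (A : Fin (M + 2) → Fin (M + 2) → ℕ → ℕ → GluingRing R) (d : ℕ) :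
    IsUnit (gluingMatrix A (gluingCoeff E) d).det := by
  rw [PowerSeries.isUnit_iff_constantCoeff, RingHom.map_det]
  have : PowerSeries.constantCoeff.mapMatrix (gluingMatrix A (gluingCoeff E) d) = 1 := by
    rw [gluingMatrix, map_add, map_mul, map_one, add_eq_left]
    have h0 : PowerSeries.constantCoeff.mapMatrix (Matrix.of fun h p : modes 2 d =>
        gluingCoeff E p.1.1 h.1.1 p.1.2 h.1.2) = 0 := by
      ext1 h p
      exact constantCoeff_gluingCoeff E _ _ _ _
    rw [h0, zero_mul]
  rw [this, Matrix.det_one]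
  exact isUnit_one

theorem isUnit_det_gluingMatrix_map {K K' : Type*} [CommRing K] [CommRing K'] (φ : K →+* K')
    {M L : ℕ} {A : Fin (M + L) → Fin (M + L) → ℕ → ℕ → K} {E : Fin L → Fin L → ℕ → ℕ → K} {d : ℕ}
    (h : IsUnit (gluingMatrix A E d).det) :
    IsUnit (gluingMatrix (fun i j m n => φ (A i j m n)) (fun i j m n => φ (E i j m n)) d).det := by
  have h1 : gluingMatrix (fun i j m n => φ (A i j m n)) (fun i j m n => φ (E i j m n)) d =
      φ.mapMatrix (gluingMatrix A E d) := by
    rw [gluingMatrix, gluingMatrix, map_add, map_mul, map_one]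
    rfl
  rw [h1, ← RingHom.map_det]
  exact h.map φ

variable [Algebra ℚ R]

theorem reduction_gluingVector (E : Fin 2 → Fin 2 → ℕ → ℕ → GluingRing R) (d : ℕ) (t : State 2) :
    reduction R d (gluingVector E t) =
      bogoliubov (fun i j m n => reduction R d (gluingCoeff E i j m n)) t :=
  congrFun (map_bogoliubov (reduction R d) (gluingCoeff E)) t

theorem coeff_mul_gluingVector (E : Fin 2 → Fin 2 → ℕ → ℕ → GluingRing R) {d k : ℕ} (hk : k < d)
    (v : FockVector (GluingRing R) 2) {t : State 2} (ht : ¬ BoundedBy d t) :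
    PowerSeries.coeff k (v t * gluingVector E t) = 0 := by
  have h1 : reduction R d (gluingVector E t) = 0 := by
    rw [reduction_gluingVector]
    by_contra hc
    exact ht (boundedBy_of_bogoliubov_ne_zero (reduction_gluingCoeff E d) t hc)
  refine reduction_eq_zero_iff.1 ?_ k hk
  rw [map_mul, h1, mul_zero]

theorem innerConverges_gluingVector (E : Fin 2 → Fin 2 → ℕ → ℕ → GluingRing R)
    (v : FockVector (GluingRing R) 2) : InnerConverges v (gluingVector E) := by
  intro d
  refine (finite_boundedBy 2 (d + 1)).subset fun t ht => ?_
  by_contra hc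
  exact ht (coeff_mul_gluingVector E (Nat.lt_succ_self d) v hc)

theorem reduction_innerProduct (E : Fin 2 → Fin 2 → ℕ → ℕ → GluingRing R)
    (v : FockVector (GluingRing R) 2) (d : ℕ) :
    reduction R d (innerProduct v (gluingVector E)) =
      ∑ t ∈ boundedStates 2 d, reduction R d (v t) * reduction R d (gluingVector E t) := by
  simp only [← map_mul]
  rw [← map_sum, ← sub_eq_zero, ← map_sub, reduction_eq_zero_iff]
  intro k hk
  rw [map_sub, sub_eq_zero, map_sum, innerProduct, PowerSeries.coeff_mk]
  refine finsum_eq_sum_of_support_subset _ fun t ht => ?_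
  rw [Finset.mem_coe, mem_boundedStates]
  by_contra hc
  exact ht (coeff_mul_gluingVector E hk v hc)

/-- Modulo `Q` the gluing vector is the vacuum, so the constant term of the inner product is `1`. -/
theorem isUnit_innerProduct_gluingVector (E : Fin 2 → Fin 2 → ℕ → ℕ → GluingRing R)
    (B : Fin 2 → Fin 2 → ℕ → ℕ → GluingRing R) :
    IsUnit (innerProduct (bogoliubov B) (gluingVector E)) := by
  rw [PowerSeries.isUnit_iff_constantCoeff, ← PowerSeries.coeff_zero_eq_constantCoeff_apply,
    innerProduct, PowerSeries.coeff_mk, finsum_eq_single _ fun _ => AdmissibleSet.vacuum]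
  · rw [bogoliubov_vacuum, gluingVector, bogoliubov_vacuum, mul_one,
      PowerSeries.coeff_zero_eq_constantCoeff_apply, map_one]
    exact isUnit_one
  · intro t ht
    rw [PowerSeries.coeff_zero_eq_constantCoeff_apply, map_mul]
    have h1 : PowerSeries.constantCoeff (gluingVector E t) =
        bogoliubov (fun i j m n => PowerSeries.constantCoeff (gluingCoeff E i j m n)) t :=
      congrFun (map_bogoliubov PowerSeries.constantCoeff (gluingCoeff E)) t
    rw [h1]
    by_contra hc
    -- All constant terms of the coefficients vanish, so the support bound holds with `d = 0`, and
    -- the only state with an empty window is the vacuum.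
    have h2 := boundedBy_of_bogoliubov_ne_zero (d := 0)
      (fun i j m n _ => constantCoeff_gluingCoeff E i j m n) t (right_ne_zero_of_mul hc)
    refine ht (State.ext_mem fun i r => ?_)
    rw [AdmissibleSet.mem_vacuum]
    by_cases hr : r < 0
    · have h3 := (h2 i).2 (-r - 1).toNat (Nat.zero_le _)
      rw [show -(((-r - 1).toNat : ℕ) : ℤ) - 1 = r by omega] at h3
      exact iff_of_true h3 hr
    · have h3 := (h2 i).1 r.toNat (Nat.zero_le _)
      rw [show ((r.toNat : ℕ) : ℤ) = r by omega] at h3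
      exact iff_of_false h3 hr

variable {M : ℕ} (E : Fin 2 → Fin 2 → ℕ → ℕ → GluingRing R)
  (A : Fin (M + 2) → Fin (M + 2) → ℕ → ℕ → GluingRing R)

theorem selfGluing_vacuum :
    selfGluing E (bogoliubov A) (fun _ => AdmissibleSet.vacuum) = selfGluingClosed E A := by
  unfold selfGluing selfGluingClosed closedVector
  rw [← bogoliubov_append_vacuum A]
  rfl

theorem reduction_selfGluing (d : ℕ) (s : State M) :
    reduction R d (selfGluing E (bogoliubov A) s) =
      pairing (bogoliubov fun i j m n => reduction R d (A i j m n))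
        (bogoliubov fun i j m n => reduction R d (gluingCoeff E i j m n)) s := by
  rw [selfGluing, reduction_innerProduct,
    pairing_eq_sum (boundedBy_of_bogoliubov_ne_zero (reduction_gluingCoeff E d))]
  refine Finset.sum_congr rfl fun t _ => ?_
  rw [reduction_gluingVector, ← map_bogoliubov (reduction R d) A]
  rfl

/-- Modulo `Q ^ d` the gluing is a multiple of a Bogoliubov transform. The multiple is the reduced
closed part, which the normalization cancels. -/
theorem exists_reduction_normalizedSelfGluing (d : ℕ) :
    ∃ S : Fin M → Fin M → ℕ → ℕ → _,
      (fun s => reduction R d (normalizedSelfGluing E A (bogoliubov A) s)) = bogoliubov S := by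
  obtain ⟨S, hS⟩ := exists_contractHoles_pairing (reduction_gluingCoeff E d)
    (isUnit_det_gluingMatrix_map (reduction R d) (isUnit_det_gluingMatrix E A d))
  refine ⟨S, ?_⟩
  have h1 := eq_smul_bogoliubov hS fun s hs => pairing_bogoliubov_of_totalCharge _ _ hs
  have hc : IsUnit (selfGluingClosed E A) := isUnit_innerProduct_gluingVector E _
  funext s
  rw [normalizedSelfGluing, map_mul, reduction_selfGluing, h1, ← reduction_selfGluing,
    selfGluing_vacuum, Pi.smul_apply, smul_eq_mul, mul_right_comm, ← map_mul,
    Ring.mul_inverse_cancel _ hc, map_one, one_mul]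

theorem isBogoliubov_normalizedSelfGluing :
    IsBogoliubov (normalizedSelfGluing E A (bogoliubov A)) := by
  -- Reading the coefficients off from the vector over the full ring avoids choosing compatible
  -- lifts of the coefficients found modulo each `Q ^ d`.
  refine ⟨fun i j m n =>
    opSign _ (removeMode (fun _ => AdmissibleSet.vacuum) j (-(n : ℤ) - 1)) j (-(n : ℤ) - 1) *
      psiStar i (m : ℤ) (normalizedSelfGluing E A (bogoliubov A))
        (removeMode (fun _ => AdmissibleSet.vacuum) j (-(n : ℤ) - 1)), ?_⟩
  funext s
  refine eq_of_reduction_eq fun d => ?_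
  obtain ⟨S, hS⟩ := exists_reduction_normalizedSelfGluing E A d
  rw [congrFun hS s, congrFun (map_bogoliubov (reduction R d) _) s]
  congr 1
  funext i j m n
  rw [map_mul, map_opSign, map_psiStar, hS]
  exact coeff_eq_of_bogoliubov S i j m n

end Gluing

end Bogoliubov

end

theorem mainTheorem3 {R : Type*} [CommRing R] [Algebra ℚ R] (M N : ℕ)
    (E : Fin 2 → Fin 2 → ℕ → ℕ → Bogoliubov.GluingRing R)
    (A₁ : Fin (M + 1) → Fin (M + 1) → ℕ → ℕ → Bogoliubov.GluingRing R)
    (A₂ : Fin (N + 1) → Fin (N + 1) → ℕ → ℕ → Bogoliubov.GluingRing R)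
    (V₁ : Bogoliubov.FockVector (Bogoliubov.GluingRing R) (M + 1))
    (V₂ : Bogoliubov.FockVector (Bogoliubov.GluingRing R) (N + 1))
    (hV₁ : V₁ = Bogoliubov.bogoliubov A₁) (hV₂ : V₂ = Bogoliubov.bogoliubov A₂) :
    Bogoliubov.tensor V₁ V₂ = Bogoliubov.bogoliubov (Bogoliubov.tensorCoeff A₁ A₂) ∧
    (∀ s : Bogoliubov.State (M + N),
      Bogoliubov.InnerConverges (Bogoliubov.slice (Bogoliubov.tensor V₁ V₂) s)
        (Bogoliubov.gluingVector E)) ∧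
    Bogoliubov.InnerConverges (Bogoliubov.closedVector (Bogoliubov.tensorCoeff A₁ A₂))
      (Bogoliubov.gluingVector E) ∧
    IsUnit (Bogoliubov.selfGluingClosed E (Bogoliubov.tensorCoeff A₁ A₂)) ∧
    Bogoliubov.IsBogoliubov (Bogoliubov.normalizedGluing E A₁ A₂ V₁ V₂) := by
  subst hV₁ hV₂
  refine ⟨Bogoliubov.tensor_bogoliubov A₁ A₂,
    fun s => Bogoliubov.innerConverges_gluingVector E _,
    Bogoliubov.innerConverges_gluingVector E _,
    Bogoliubov.isUnit_innerProduct_gluingVector E _, ?_⟩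
  -- From here the block form of the coefficients plays no role: the self-gluing of any Bogoliubov
  -- transform is again one after normalization.
  rw [Bogoliubov.normalizedGluing, Bogoliubov.tensor_bogoliubov]
  exact Bogoliubov.isBogoliubov_normalizedSelfGluing E _
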